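/- There exists an absolute constant $c>0$ such that for every function $p:\mathbb N\to[0,1]$ the following holds. Let $G(n,p(n))$ be the random graph on the vertex set $\{1,\dots,n\}$ in which each of the $\binom n2$ possible edges is present independently with probability $p(n)$. Then the probability that $G(n,p(n))$ can be decomposed into at most $cn$ cycles and edges tends to $1$ as $n\to\infty$. Here a graph is decomposed into cycles and edges if its edge set is partitioned into parts each of which is the edge set of a cycle of the graph or consists of a single edge of the graph. -/

import Mathlib

namespace CycleDecomp

variable {V : Type*}

/-- `S` is the edge set of a cycle (of length at least three) of the graph `G`. -/
def IsCycleEdgeSet (G : SimpleGraph V) (S : Set (Sym2 V)) : Prop :=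
  ∃ (v : V) (w : G.Walk v v), w.IsCycle ∧ S = w.edgeSet

/-- `S` consists of a single edge of the graph `G`. -/
def IsSingleEdge (G : SimpleGraph V) (S : Set (Sym2 V)) : Prop :=
  ∃ e ∈ G.edgeSet, S = {e}

/-- `D` is a decomposition of `G` into cycles and edges: a partition of the edge set of `G` all
of whose parts are either edge sets of cycles of `G` or single edges of `G`. -/
structure IsCycleEdgeDecomposition (G : SimpleGraph V) (D : Finset (Set (Sym2 V))) : Prop where
  cycle_or_edge : ∀ S ∈ D, IsCycleEdgeSet G S ∨ IsSingleEdge G S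
  disjoint : ∀ S ∈ D, ∀ T ∈ D, S ≠ T → Disjoint S T
  cover : ∀ e : Sym2 V, e ∈ G.edgeSet ↔ ∃ S ∈ D, e ∈ S

/-- `G` can be decomposed into at most `x` cycles and edges. -/
def DecomposableIntoAtMost (G : SimpleGraph V) (x : ℝ) : Prop :=
  ∃ D : Finset (Set (Sym2 V)), IsCycleEdgeDecomposition G D ∧ (D.card : ℝ) ≤ x

/-- For the sequence `p` of edge probabilities, the binomial random graphs `G(n, p n)` on `n`
labelled vertices have the property `P` asymptotically almost surely. -/
def RandomGraphAAS (p : ℕ → unitInterval) (P : (n : ℕ) → SimpleGraph (Fin n) → Prop) : Prop :=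
  Filter.Tendsto (fun n : ℕ => SimpleGraph.binomialRandom (Fin n) (p n) {G | P n G})
    Filter.atTop (nhds 1)

end CycleDecomp

/-! Let `a` be the integer part of the 40th root of n, and call a graph locally sparse if every
nonempty vertex set X spans at most 44|X| + 2|X|²/a edges, a property inherited by subgraphs. A
locally sparse graph with m > 176n edges has a cycle of length at least am/(32n): a subset U on
which every W touches at least (m/n)|W| edges must expand, and expansion yields long cycles
(`LocallySparse.exists_long_cycle`). Deleting such cycles n times scales the number of edges by at
most exp(-a/32), so n cycles and 176n single edges suffice (`LocallySparse.edgeDecomposable`). For p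
≤ a⁻² the random graph is locally sparse with high probability, by a first moment bound
(`measureReal_not_locallySparse_le`).

For p ≥ a⁻² fix a locally sparse graph T in which all codegrees are of order n/a⁵; it exists because
G(n, a⁻²) has these properties with positive probability. Then L = G ∩ T is locally sparse and, with
high probability, has all codegrees of order n/a¹⁰. The graph G - L splits into a forest and n paths
such that every vertex is an end of exactly two paths (`exists_isPathFamily`). Edge-disjoint paths
of length two in L, found greedily (`exists_links`), close each path into at most two cycles. What
is left of L is still locally sparse. The total is 2n + n + 177n = 180n. -/

namespace CycleDecomp

/-! ### Partitions of edge sets into cycles and single edges. -/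

section Decomposition

variable {V : Type*} {G H : SimpleGraph V} {E F : Set (Sym2 V)} {k l : ℕ}

/-- The edges in `E` can be partitioned into at most `k` parts, each of which is the edge set of a
cycle of `G` or a single edge of `G`. -/
def EdgeDecomposable (G : SimpleGraph V) (E : Set (Sym2 V)) (k : ℕ) : Prop :=
  ∃ D : Finset (Set (Sym2 V)), (∀ S ∈ D, IsCycleEdgeSet G S ∨ IsSingleEdge G S) ∧
    (∀ S ∈ D, ∀ T ∈ D, S ≠ T → Disjoint S T) ∧ (∀ e, e ∈ E ↔ ∃ S ∈ D, e ∈ S) ∧ D.card ≤ k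

theorem EdgeDecomposable.mono (h : EdgeDecomposable G E k) (hkl : k ≤ l) :
    EdgeDecomposable G E l := by
  obtain ⟨D, h1, h2, h3, h4⟩ := h
  exact ⟨D, h1, h2, h3, h4.trans hkl⟩

theorem EdgeDecomposable.empty : EdgeDecomposable G ∅ 0 :=
  ⟨∅, by simp, by simp, by simp, by simp⟩

theorem EdgeDecomposable.union (hE : EdgeDecomposable G E k) (hF : EdgeDecomposable G F l)
    (hd : Disjoint E F) : EdgeDecomposable G (E ∪ F) (k + l) := by
  classical
  obtain ⟨D, h1, h2, h3, h4⟩ := hE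
  obtain ⟨D', h1', h2', h3', h4'⟩ := hF
  have key : ∀ S ∈ D, ∀ T ∈ D', Disjoint S T := fun S hS T hT =>
    hd.mono (fun e he => (h3 e).2 ⟨S, hS, he⟩) (fun e he => (h3' e).2 ⟨T, hT, he⟩)
  refine ⟨D ∪ D', ?_, ?_, ?_, (Finset.card_union_le _ _).trans (by omega)⟩
  · intro S hS
    rcases Finset.mem_union.1 hS with hS | hS
    exacts [h1 S hS, h1' S hS]
  · intro S hS T hT hST
    rcases Finset.mem_union.1 hS with hS | hS <;> rcases Finset.mem_union.1 hT with hT | hT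
    exacts [h2 S hS T hT hST, key S hS T hT, (key T hT S hS).symm, h2' S hS T hT hST]
  · intro e
    simp only [Set.mem_union, h3, h3', Finset.mem_union]
    constructor
    · rintro (⟨S, hS, he⟩ | ⟨S, hS, he⟩)
      exacts [⟨S, .inl hS, he⟩, ⟨S, .inr hS, he⟩]
    · rintro ⟨S, hS | hS, he⟩
      exacts [.inl ⟨S, hS, he⟩, .inr ⟨S, hS, he⟩]

theorem EdgeDecomposable.biUnion {ι : Type*} (s : Finset ι) (E : ι → Set (Sym2 V)) (k : ℕ)
    (h : ∀ i ∈ s, EdgeDecomposable G (E i) k)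
    (hd : ∀ i ∈ s, ∀ j ∈ s, i ≠ j → Disjoint (E i) (E j)) :
    EdgeDecomposable G (⋃ i ∈ s, E i) (k * s.card) := by
  classical
  induction s using Finset.induction_on with
  | empty => simpa using EdgeDecomposable.empty
  | insert a s ha ih =>
    rw [Finset.set_biUnion_insert, Finset.card_insert_of_notMem ha, mul_add, mul_one, add_comm]
    refine (h a (by simp)).union (ih (fun i hi => h i (by simp [hi]))
      (fun i hi j hj => hd i (by simp [hi]) j (by simp [hj]))) ?_
    rw [Set.disjoint_iUnion₂_right]
    intro i hi
    exact hd a (by simp) i (by simp [hi]) (by rintro rfl; exact ha hi)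

theorem EdgeDecomposable.of_isCycle {v : V} {w : G.Walk v v} (hw : w.IsCycle) :
    EdgeDecomposable G w.edgeSet 1 :=
  ⟨{w.edgeSet}, by simpa using .inl ⟨v, w, hw, rfl⟩, by simp, by simp, by simp⟩

theorem EdgeDecomposable.of_subset_edgeSet (hE : E ⊆ G.edgeSet) (hf : E.Finite) :
    EdgeDecomposable G E E.ncard := by
  classical
  lift E to Finset (Sym2 V) using hf
  refine ⟨E.image (fun e => {e}), ?_, ?_, ?_, ?_⟩
  · simp only [Finset.mem_image, forall_exists_index, and_imp, forall_apply_eq_imp_iff₂]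
    exact fun e he => .inr ⟨e, hE he, rfl⟩
  · simp only [Finset.mem_image, forall_exists_index, and_imp, forall_apply_eq_imp_iff₂]
    intro e _ f _ h
    simpa using h
  · simp
  · rw [Set.ncard_coe_finset]
    exact Finset.card_image_le

theorem EdgeDecomposable.decomposableIntoAtMost (h : EdgeDecomposable G G.edgeSet k) {x : ℝ}
    (hx : (k : ℝ) ≤ x) : DecomposableIntoAtMost G x := by
  obtain ⟨D, h1, h2, h3, h4⟩ := h
  exact ⟨D, ⟨h1, h2, h3⟩, le_trans (by exact_mod_cast h4) hx⟩

theorem EdgeDecomposable.of_isCycle_of_le (hHG : H ≤ G) {v : V} {w : H.Walk v v}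
    (hw : w.IsCycle) : EdgeDecomposable G w.edgeSet 1 := by
  have := EdgeDecomposable.of_isCycle ((SimpleGraph.Walk.isCycle_mapLe hHG).2 hw)
  convert this using 1
  ext e
  simp [SimpleGraph.Walk.edgeSet]

end Decomposition

/-! ### Long cycles from vertex expansion. -/

section LongCycle

variable {V : Type*} [Fintype V] [DecidableEq V] {G : SimpleGraph V}

open scoped Classical in
/-- The set of vertices outside `W` with a neighbour in `W`. -/
noncomputable def outerNeighbors (G : SimpleGraph V) (W : Finset V) : Finset V :=
  Finset.univ.filter fun u => u ∉ W ∧ ∃ w ∈ W, G.Adj w u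

theorem mem_outerNeighbors {W : Finset V} {u : V} :
    u ∈ outerNeighbors G W ↔ u ∉ W ∧ ∃ w ∈ W, G.Adj w u := by
  simp [outerNeighbors]

/-- Otherwise all of `N` would lie in the last `t - 1` positions of `p`. -/
theorem exists_long_dropUntil {a v : V} (p : G.Walk a v) (N : Finset V) (t : ℕ)
    (hN : ∀ u ∈ N, u ∈ p.support) (ht : t ≤ N.card) (ht0 : 0 < t) :
    ∃ u, ∃ hu : u ∈ p.support, u ∈ N ∧ t ≤ (p.dropUntil u hu).length + 1 := by
  by_contra! hcon
  have h1 : ∀ u ∈ N, ∃ i, i < t - 1 ∧ p.reverse.getVert i = u := by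
    intro u hu
    have hs := hN u hu
    have h2 := hcon u hs hu
    refine ⟨(p.dropUntil u hs).length, by omega, ?_⟩
    rw [SimpleGraph.Walk.getVert_reverse]
    have h3 : p.length - (p.dropUntil u hs).length = (p.takeUntil u hs).length := by
      have := congrArg SimpleGraph.Walk.length (p.take_spec hs)
      rw [SimpleGraph.Walk.length_append] at this
      omega
    rw [h3]
    exact SimpleGraph.Walk.getVert_length_takeUntil hs
  have h2 : N ⊆ (Finset.range (t - 1)).image (fun i => p.reverse.getVert i) := by
    intro u hu
    obtain ⟨i, hi, h⟩ := h1 u hu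
    exact Finset.mem_image.2 ⟨i, by simpa using hi, h⟩
  have := (Finset.card_le_card h2).trans Finset.card_image_le
  rw [Finset.card_range] at this
  omega

/-- A depth-first search: `p` is the current path and `X` is unexplored territory that is attached
to its end `v` and has no other neighbours outside `p`. The search keeps `X` of size at least `t`
and shrinks it until it has size at most `2 * t`. Then expansion gives `t` neighbours of `X` on `p`,
one of them far from `v`, and a path through `X` closes the cycle. -/
theorem exists_long_cycle_of_path (t : ℕ) (ht : 2 ≤ t) (U : Finset V)
    (hexp : ∀ W ⊆ U, t ≤ W.card → W.card ≤ 2 * t → t ≤ (outerNeighbors G W).card) :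
    ∀ (m : ℕ) (X : Finset V) (a v : V) (p : G.Walk a v), X ⊆ U → X.card ≤ m → p.IsPath → t ≤ X.card →
      (∀ x ∈ X, x ∉ p.support) → (∀ u ∈ outerNeighbors G X, u ∈ p.support) →
      (∀ x ∈ X, ∃ q : G.Walk x v, q.IsPath ∧ ∀ z ∈ q.support, z ∈ X ∨ z = v) →
      ∃ (b : V) (c : G.Walk b b), c.IsCycle ∧ t + 1 ≤ c.length := by
  classical
  intro m
  induction m with
  | zero => intro X a v p _ hm _ ht'; omega
  | succ m ih =>
    intro X a v p hXU hm hp htX hXp hN hreach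
    by_cases hsmall : X.card ≤ 2 * t
    · obtain ⟨u, hu, huN, hlen⟩ := exists_long_dropUntil p _ t hN (hexp X hXU htX hsmall) (by omega)
      obtain ⟨huX, x, hx, hxu⟩ := mem_outerNeighbors.1 huN
      obtain ⟨q, hq, hqX⟩ := hreach x hx
      have huv : u ≠ v := by
        rintro rfl
        have h0 : (p.dropUntil u hu).length = 0 := by
          have := hp.dropUntil hu
          rw [SimpleGraph.Walk.isPath_iff_nil] at this
          exact SimpleGraph.Walk.length_eq_zero_iff.2 this
        omega
      set d := p.dropUntil u hu with hd
      have hdp : d.IsPath := hp.dropUntil hu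
      have hds : ∀ z ∈ d.support, z ∈ p.support := p.support_dropUntil_subset_support hu
      have hxp := hXp x hx
      -- The cycle goes from `x` to `u`, along `p` to `v`, and back to `x` through `X`; its length
      -- is at least 1 + (t - 1) + 1.
      refine ⟨x, .cons hxu (d.append q.reverse), ?_, ?_⟩
      · rw [SimpleGraph.Walk.cons_isCycle_iff]
        constructor
        · rw [SimpleGraph.Walk.isPath_def, SimpleGraph.Walk.support_append, List.nodup_append]
          refine ⟨hdp.support_nodup, (hq.reverse.support_nodup).tail, ?_⟩
          rintro z hz z' hz' rfl
          have hz2 : z ∈ q.reverse.support := List.mem_of_mem_tail hz'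
          have hzq : z ∈ q.support := by simpa using hz2
          rcases hqX z hzq with h | h
          · exact hXp z h (hds z hz)
          · subst h
            have h3 := hq.reverse.support_nodup
            rw [← SimpleGraph.Walk.cons_tail_support] at h3
            exact (List.nodup_cons.1 h3).1 hz'
        · rw [SimpleGraph.Walk.edges_append, List.mem_append, not_or]
          constructor
          · intro h
            exact hxp (hds _ (d.fst_mem_support_of_mem_edges h))
          · intro h
            have := q.reverse.snd_mem_support_of_mem_edges h
            rcases hqX u (by simpa using this) with h | h
            exacts [huX h, huv h]
      · have hql : 1 ≤ q.length := by
          rcases Nat.eq_zero_or_pos q.length with h | h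
          · exact absurd (SimpleGraph.Walk.eq_of_length_eq_zero h) (by
              rintro rfl; exact hxp p.end_mem_support)
          · exact h
        simp only [SimpleGraph.Walk.length_cons, SimpleGraph.Walk.length_append,
          SimpleGraph.Walk.length_reverse]
        omega
    · have hXne : X.Nonempty := Finset.card_pos.1 (by omega)
      have hvX : v ∉ X := fun h => hXp v h p.end_mem_support
      obtain ⟨w, hwX, hwv⟩ : ∃ w ∈ X, G.Adj v w := by
        obtain ⟨x, hx⟩ := hXne
        obtain ⟨q, hq, hqX⟩ := hreach x hx
        have hnn : ¬ q.reverse.Nil := by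
          intro h
          have := h.eq
          subst this
          exact hvX hx
        refine ⟨q.reverse.snd, ?_, q.reverse.adj_snd hnn⟩
        rcases hqX q.reverse.snd (by
          simp) with h | h
        · exact h
        · exact absurd h (q.reverse.adj_snd hnn).ne'
      -- The component of `w` in the graph induced on `X`.
      set C : Finset V := X.filter fun x => ∃ q : G.Walk x w, ∀ z ∈ q.support, z ∈ X with hC
      have hwC : w ∈ C := by
        simp only [hC, Finset.mem_filter]
        exact ⟨hwX, .nil, by simpa using hwX⟩
      have hCX : C ⊆ X := Finset.filter_subset _ _
      have hclosed : ∀ x ∈ X, ∀ y ∈ C, G.Adj x y → x ∈ C := by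
        intro x hx y hy hxy
        simp only [hC, Finset.mem_filter] at hy ⊢
        obtain ⟨_, q, hq⟩ := hy
        exact ⟨hx, .cons hxy q, by simpa [hx] using hq⟩
      have hcard := Finset.card_sdiff_add_card_eq_card hCX
      -- Either `C` can be discarded, or fewer than `t` vertices lie outside `C`. In the second case
      -- `C` without `w` still has at least `t` vertices, and the path advances to `w`.
      by_cases hbig : t ≤ (X \ C).card
      · refine ih (X \ C) a v p (Finset.sdiff_subset.trans hXU) ?_ hp hbig (fun x hx => hXp x (Finset.mem_sdiff.1 hx).1) ?_ ?_
        · have := Finset.card_pos.2 ⟨w, hwC⟩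
          omega
        · intro u hu
          obtain ⟨h1, x, hx, hxu⟩ := mem_outerNeighbors.1 hu
          obtain ⟨hxX, hxC⟩ := Finset.mem_sdiff.1 hx
          by_cases huX : u ∈ X
          · have huC : u ∈ C := by
              by_contra h
              exact h1 (Finset.mem_sdiff.2 ⟨huX, h⟩)
            exact absurd (hclosed x hxX u huC hxu) hxC
          · exact hN u (mem_outerNeighbors.2 ⟨huX, x, hxX, hxu⟩)
        · intro x hx
          obtain ⟨hxX, hxC⟩ := Finset.mem_sdiff.1 hx
          obtain ⟨q, hq, hqX⟩ := hreach x hxX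
          refine ⟨q, hq, fun z hz => ?_⟩
          rcases hqX z hz with h | h
          · left
            refine Finset.mem_sdiff.2 ⟨h, fun hzC => hxC ?_⟩
            have hzv : z ≠ v := by rintro rfl; exact hvX h
            have h2 := SimpleGraph.Walk.endpoint_notMem_support_takeUntil hq hz hzv.symm
            simp only [hC, Finset.mem_filter] at hzC ⊢
            obtain ⟨_, r, hr⟩ := hzC
            refine ⟨hxX, (q.takeUntil z hz).append r, fun y hy => ?_⟩
            rcases SimpleGraph.Walk.mem_support_append_iff _ _ |>.1 hy with hy | hy
            · rcases hqX y (q.support_takeUntil_subset_support hz hy) with h | h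
              · exact h
              · subst h
                exact absurd hy h2
            · exact hr y hy
          · exact .inr h
      · have hCc : t ≤ (C.erase w).card := by
          rw [Finset.card_erase_of_mem hwC]
          omega
        have hsub : C.erase w ⊆ X := (Finset.erase_subset _ _).trans hCX
        refine ih (C.erase w) a w (p.concat hwv) (hsub.trans hXU) ?_ (hp.concat (hXp w hwX) hwv) hCc ?_ ?_ ?_
        · have := Finset.card_le_card hCX
          rw [Finset.card_erase_of_mem hwC]
          omega
        · intro x hx
          rw [SimpleGraph.Walk.support_concat]
          simp only [List.mem_append, List.mem_singleton, not_or]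
          exact ⟨hXp x (hsub hx), Finset.ne_of_mem_erase hx⟩
        · intro u hu
          obtain ⟨h1, x, hx, hxu⟩ := mem_outerNeighbors.1 hu
          rw [SimpleGraph.Walk.support_concat]
          simp only [List.mem_append, List.mem_singleton]
          by_cases huw : u = w
          · exact .inr huw
          left
          by_cases huX : u ∈ X
          · have := hclosed u huX x (Finset.mem_of_mem_erase hx) hxu.symm
            exact absurd (Finset.mem_erase.2 ⟨huw, this⟩) h1
          · exact hN u (mem_outerNeighbors.2 ⟨huX, x, hsub hx, hxu⟩)
        · intro x hx
          have hxC := Finset.mem_of_mem_erase hx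
          have hxC' := hxC
          simp only [hC, Finset.mem_filter] at hxC
          obtain ⟨hxX, q, hq⟩ := hxC
          refine ⟨q.bypass, q.bypass_isPath, fun z hz => ?_⟩
          by_cases hzw : z = w
          · exact .inr hzw
          refine .inl (Finset.mem_erase.2 ⟨hzw, ?_⟩)
          have hz' := q.support_bypass_subset_support hz
          simp only [hC, Finset.mem_filter]
          exact ⟨hq z hz', q.dropUntil z hz', fun y hy =>
            hq y (q.support_dropUntil_subset_support hz' hy)⟩

/-- A graph in which all small sets of vertices of `U` expand has a long cycle. -/
theorem exists_long_cycle_of_expansion (t : ℕ) (ht : 2 ≤ t) (U : Finset V) (hU : U.Nonempty)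
    (hGU : ∀ x y, G.Adj x y → x ∈ U)
    (hexp : ∀ W ⊆ U, W.Nonempty → W.card ≤ 2 * t →
      min W.card t ≤ (outerNeighbors G W).card) :
    ∃ (b : V) (c : G.Walk b b), c.IsCycle ∧ t + 1 ≤ c.length := by
  classical
  obtain ⟨a, ha⟩ := hU
  -- restrict attention to the component of `a`
  set K : Finset V := Finset.univ.filter fun x => G.Reachable x a with hK
  have haK : a ∈ K := by simp [hK]
  have hKU : K ⊆ U := by
    intro x hx
    have hx : G.Reachable x a := by simpa [hK] using hx
    obtain ⟨q⟩ := hx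
    cases q with
    | nil => exact ha
    | cons h _ => exact hGU _ _ h
  have hKN : outerNeighbors G K = ∅ := by
    refine Finset.eq_empty_of_forall_notMem fun u hu => ?_
    obtain ⟨h1, x, hx, hxu⟩ := mem_outerNeighbors.1 hu
    simp only [hK, Finset.mem_filter, Finset.mem_univ, true_and] at h1 hx
    exact h1 (hxu.symm.reachable.trans hx)
  -- A component has no outer neighbours, so it is too large for the expansion hypothesis.
  have hKc : 2 * t < K.card := by
    by_contra! h
    have := hexp K hKU ⟨a, haK⟩ h
    rw [hKN, Finset.card_empty] at this
    have := Finset.card_pos.2 ⟨a, haK⟩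
    omega
  have hNa : ∀ u ∈ outerNeighbors G (K.erase a), u = a := by
    intro u hu
    obtain ⟨h1, x, hx, hxu⟩ := mem_outerNeighbors.1 hu
    by_contra hua
    have hxK : G.Reachable x a := by simpa [hK] using Finset.mem_of_mem_erase hx
    refine h1 (Finset.mem_erase.2 ⟨hua, ?_⟩)
    simpa [hK] using hxu.symm.reachable.trans hxK
  have hreach : ∀ x ∈ K.erase a, ∃ q : G.Walk x a, q.IsPath ∧
      ∀ z ∈ q.support, z ∈ K.erase a ∨ z = a := by
    intro x hx
    have hxK : G.Reachable x a := by simpa [hK] using Finset.mem_of_mem_erase hx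
    obtain ⟨q, hq⟩ := hxK.exists_isPath
    refine ⟨q, hq, fun z hz => ?_⟩
    by_cases hza : z = a
    · exact .inr hza
    · refine .inl (Finset.mem_erase.2 ⟨hza, ?_⟩)
      simpa [hK] using (q.dropUntil z hz).reachable
  have hcard : (K.erase a).card + 1 = K.card := Finset.card_erase_add_one haK
  refine exists_long_cycle_of_path t ht (K.erase a) ?_ _ (K.erase a) a a .nil subset_rfl le_rfl
    .nil (by omega) (fun x hx => by simpa using Finset.ne_of_mem_erase hx) (by simpa using hNa) hreach
  intro W hW h1 h2
  have := hexp W (hW.trans ((Finset.erase_subset _ _).trans hKU)) (Finset.card_pos.1 (by omega)) h2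
  rwa [min_eq_right h1] at this

end LongCycle

/-! ### Locally sparse graphs and repeated removal of long cycles. -/

section LocallySparse

variable {V : Type*} {G H : SimpleGraph V} {a : ℕ}

open scoped Classical in
/-- The edges of `G` with both ends in `X`. -/
noncomputable def edgesIn (G : SimpleGraph V) (X : Finset V) : Finset (Sym2 V) :=
  X.sym2.filter (· ∈ G.edgeSet)

theorem mem_edgesIn {X : Finset V} {e : Sym2 V} :
    e ∈ edgesIn G X ↔ (∀ v ∈ e, v ∈ X) ∧ e ∈ G.edgeSet := by
  simp [edgesIn, Finset.mem_sym2_iff]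

theorem coe_edgesIn_univ [Fintype V] : (edgesIn G Finset.univ : Set (Sym2 V)) = G.edgeSet := by
  ext e
  simp [mem_edgesIn]

/-- Every set `X` of vertices spans at most `44 |X| + 2 |X| ^ 2 / a` edges. -/
def LocallySparse (G : SimpleGraph V) (a : ℕ) : Prop :=
  ∀ X : Finset V, X.Nonempty → a * (edgesIn G X).card ≤ 44 * a * X.card + 2 * X.card ^ 2

theorem LocallySparse.anti (hG : LocallySparse G a) (hHG : H ≤ G) : LocallySparse H a := by
  intro X hX
  refine le_trans (Nat.mul_le_mul_left _ (Finset.card_le_card ?_)) (hG X hX)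
  intro e he
  rw [mem_edgesIn] at he ⊢
  exact ⟨he.1, SimpleGraph.edgeSet_mono hHG he.2⟩

variable [Fintype V] [DecidableEq V]

/-- A graph has an induced subgraph such that every set of vertices of this subgraph
touches at least as many edges per vertex as there are in the whole graph. -/
theorem exists_dense_core [Nonempty V] (H : SimpleGraph V) (d : ℝ)
    (hd : d * Fintype.card V ≤ (edgesIn H Finset.univ).card) :
    ∃ U : Finset V, U.Nonempty ∧ ∀ W ⊆ U,
      d * W.card ≤ (edgesIn H U \ edgesIn H (U \ W)).card := by
  classical
  -- `U` maximises e(U) - d|U| over nonempty sets; deleting `W` cannot increase this, so at least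
  -- d|W| edges touch `W`.
  obtain ⟨U, hU, hmax⟩ := Finset.exists_max_image
    ((Finset.univ : Finset (Finset V)).filter Finset.Nonempty)
    (fun U => ((edgesIn H U).card : ℝ) - d * U.card) ⟨Finset.univ, by simp⟩
  simp only [Finset.mem_filter, Finset.mem_univ, true_and] at hU hmax
  refine ⟨U, hU, fun W hW => ?_⟩
  have hsub : edgesIn H (U \ W) ⊆ edgesIn H U := by
    intro e he
    rw [mem_edgesIn] at he ⊢
    exact ⟨fun v hv => (Finset.mem_sdiff.1 (he.1 v hv)).1, he.2⟩
  have h1 : ((edgesIn H U \ edgesIn H (U \ W)).card : ℝ) + (edgesIn H (U \ W)).card =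
      (edgesIn H U).card := by
    exact_mod_cast Finset.card_sdiff_add_card_eq_card hsub
  have h2 : ((U \ W).card : ℝ) + W.card = U.card := by
    exact_mod_cast Finset.card_sdiff_add_card_eq_card hW
  -- The empty set is not a competitor; for `W = U` the comparison is with the whole vertex set,
  -- whose value is nonnegative by `hd`.
  rcases (U \ W).eq_empty_or_nonempty with he | hne
  · have h3 := hmax Finset.univ Finset.univ_nonempty
    rw [Finset.card_univ] at h3
    have h4 : (edgesIn H (U \ W)).card = 0 := by
      rw [Finset.card_eq_zero, he]
      refine Finset.eq_empty_of_forall_notMem fun e => ?_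
      induction e using Sym2.ind with
      | _ x y =>
        intro h
        exact Finset.notMem_empty x ((mem_edgesIn.1 h).1 x (by simp))
    rw [he] at h2
    rw [h4] at h1
    simp only [Finset.card_empty, Nat.cast_zero, zero_add, add_zero] at h1 h2
    rw [h1, h2]
    linarith
  · have h3 := hmax _ hne
    rw [← h2, mul_add] at h3
    linarith

/-- With d = m/n, take a core `U` whose subsets W touch at least d|W| edges. If some W with |W| ≤ 2t
failed to expand, these edges would lie in a set Y with |Y| ≤ 2|W|. Local sparsity then gives d ≤ 88
+ 16t/a ≤ 88 + d/2, contrary to d > 176. -/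
theorem LocallySparse.exists_long_cycle (hG : LocallySparse G a) (ha : 0 < a)
    (hH : 176 * Fintype.card V < (edgesIn G Finset.univ).card) :
    ∃ (b : V) (c : G.Walk b b), c.IsCycle ∧
      a * (edgesIn G Finset.univ).card ≤ 32 * Fintype.card V * c.length := by
  classical
  have hne : Nonempty V := by
    by_contra h
    rw [not_nonempty_iff] at h
    have : (edgesIn G Finset.univ).card = 0 := by
      rw [Finset.card_eq_zero]
      refine Finset.eq_empty_of_forall_notMem fun e => ?_
      induction e using Sym2.ind with
      | _ x y => exact (h.false x).elim
    omega
  set n : ℝ := (Fintype.card V : ℝ) with hn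
  have hn0 : 0 < n := by
    rw [hn]
    exact_mod_cast Fintype.card_pos
  set m : ℝ := ((edgesIn G Finset.univ).card : ℝ) with hm
  have hmn : 176 * n < m := by
    rw [hm, hn]
    exact_mod_cast hH
  set d : ℝ := m / n with hd
  have hd176 : 176 < d := by rwa [hd, lt_div_iff₀ hn0]
  have hdn : d * n = m := by rw [hd]; field_simp
  obtain ⟨U, hU, hdense⟩ := exists_dense_core G d hdn.le
  have ha1 : (1 : ℝ) ≤ a := by exact_mod_cast ha
  set t : ℕ := ⌊d * a / 32⌋₊ with ht
  have hda : 176 < d * a := by nlinarith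
  have ht1 : (t : ℝ) ≤ d * a / 32 := Nat.floor_le (by positivity)
  have ht2 : d * a / 32 < t + 1 := Nat.lt_floor_add_one _
  have ht3 : 2 ≤ t := Nat.le_floor (by norm_num; linarith)
  let G' : SimpleGraph V :=
    { Adj := fun x y => G.Adj x y ∧ x ∈ U ∧ y ∈ U
      symm := ⟨fun x y h => ⟨h.1.symm, h.2.2, h.2.1⟩⟩
      loopless := ⟨fun x h => h.1.ne rfl⟩ }
  have hG'G : G' ≤ G := fun x y h => h.1
  obtain ⟨b, c, hc, hlen⟩ := exists_long_cycle_of_expansion (G := G') t ht3 U hU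
    (fun x y h => h.2.1) (by
      intro W hWU hW hWt
      by_contra! hlt
      set Y := W ∪ outerNeighbors G' W with hY
      have hYc : Y.card ≤ 2 * W.card := by
        have : Y.card ≤ W.card + (outerNeighbors G' W).card := Finset.card_union_le _ _
        have := min_le_left W.card t
        omega
      have hsub : edgesIn G U \ edgesIn G (U \ W) ⊆ edgesIn G Y := by
        intro e he
        rw [Finset.mem_sdiff, mem_edgesIn, mem_edgesIn] at he
        rw [mem_edgesIn]
        obtain ⟨⟨heU, heG⟩, hnot⟩ := he
        refine ⟨?_, heG⟩
        obtain ⟨x, hxe, hxW⟩ : ∃ x ∈ e, x ∈ W := by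
          by_contra! h
          exact hnot ⟨fun v hv => Finset.mem_sdiff.2 ⟨heU v hv, h v hv⟩, heG⟩
        intro v hv
        by_cases hvW : v ∈ W
        · exact Finset.mem_union_left _ hvW
        · refine Finset.mem_union_right _ (mem_outerNeighbors.2 ⟨hvW, x, hxW, ?_, ?_, heU v hv⟩)
          · have hne : x ≠ v := by rintro rfl; exact hvW hxW
            rwa [(Sym2.mem_and_mem_iff hne).1 ⟨hxe, hv⟩] at heG
          · exact heU x hxe
      have h1 := hdense W hWU
      have h2 : ((edgesIn G U \ edgesIn G (U \ W)).card : ℝ) ≤ (edgesIn G Y).card := by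
        exact_mod_cast Finset.card_le_card hsub
      have h3 : (a : ℝ) * (edgesIn G Y).card ≤ 44 * a * Y.card + 2 * (Y.card : ℝ) ^ 2 := by
        exact_mod_cast hG Y (hW.mono Finset.subset_union_left)
      have hw0 : (0 : ℝ) < W.card := by exact_mod_cast hW.card_pos
      have hYc' : (Y.card : ℝ) ≤ 2 * W.card := by exact_mod_cast hYc
      have hWt' : (W.card : ℝ) ≤ 2 * t := by exact_mod_cast hWt
      have h4 : (Y.card : ℝ) ^ 2 ≤ 2 * W.card * (4 * t) := by
        have : (Y.card : ℝ) ^ 2 ≤ (2 * W.card) ^ 2 := by gcongr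
        nlinarith
      have h5 : a * (d * W.card) ≤ 44 * a * (2 * W.card) + 2 * (2 * W.card * (4 * t)) := by
        calc a * (d * W.card) ≤ a * (edgesIn G Y).card := by gcongr; exact h1.trans h2
          _ ≤ 44 * a * Y.card + 2 * (Y.card : ℝ) ^ 2 := h3
          _ ≤ _ := by gcongr
      have h6 : a * d ≤ 88 * a + 16 * t := by
        have : (a * d) * W.card ≤ (88 * a + 16 * t) * W.card := by linarith
        exact le_of_mul_le_mul_right this hw0
      nlinarith)
  refine ⟨b, c.mapLe hG'G, (SimpleGraph.Walk.isCycle_mapLe hG'G).2 hc, ?_⟩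
  have h1 : (c.mapLe hG'G).length = c.length := by simp [SimpleGraph.Walk.mapLe]
  rw [h1]
  have h2 : ((t : ℝ) + 1) ≤ c.length := by exact_mod_cast hlen
  have : (a : ℝ) * m ≤ 32 * n * c.length := by
    rw [← hdn]
    nlinarith
  rw [hm, hn] at this
  exact_mod_cast this

/-- Repeatedly removing long cycles decomposes a locally sparse graph. -/
theorem LocallySparse.edgeDecomposable_of_le (hG : LocallySparse G a) (ha : 0 < a)
    (han : a ≤ 32 * Fintype.card V) (j : ℕ) : ∀ H ≤ G,
    ((edgesIn H Finset.univ).card : ℝ) * (1 - a / (32 * Fintype.card V)) ^ j ≤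
      176 * Fintype.card V →
    EdgeDecomposable G H.edgeSet (j + 176 * Fintype.card V) := by
  have hsmall : ∀ (j : ℕ), ∀ H ≤ G, (edgesIn H Finset.univ).card ≤ 176 * Fintype.card V →
      EdgeDecomposable G H.edgeSet (j + 176 * Fintype.card V) := by
    intro j H hH h
    refine (EdgeDecomposable.of_subset_edgeSet (SimpleGraph.edgeSet_mono hH)
      (Set.toFinite _)).mono ?_
    rw [← coe_edgesIn_univ, Set.ncard_coe_finset]
    omega
  have hn0 : (0 : ℝ) < Fintype.card V := by
    have : 0 < Fintype.card V := by omega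
    exact_mod_cast this
  induction j with
  | zero =>
    intro H hH h
    refine hsmall 0 H hH ?_
    rw [pow_zero, mul_one] at h
    exact_mod_cast h
  | succ j ih =>
    intro H hH h
    by_cases hs : (edgesIn H Finset.univ).card ≤ 176 * Fintype.card V
    · exact hsmall _ H hH hs
    obtain ⟨b, c, hc, hlen⟩ := (hG.anti hH).exists_long_cycle ha (not_le.1 hs)
    have hsub : c.edgeSet ⊆ H.edgeSet := fun e he => c.edges_subset_edgeSet he
    have hE : H.edgeSet = (H.deleteEdges c.edgeSet).edgeSet ∪ c.edgeSet := by
      rw [SimpleGraph.edgeSet_deleteEdges, Set.sdiff_union_of_subset hsub]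
    have hcard : (edgesIn (H.deleteEdges c.edgeSet) Finset.univ).card + c.length =
        (edgesIn H Finset.univ).card := by
      have h1 : c.edgeSet.ncard = c.length := by
        classical
        have : c.edgeSet = (c.edges.toFinset : Set (Sym2 V)) := by
          ext e; simp [SimpleGraph.Walk.edgeSet]
        rw [this, Set.ncard_coe_finset, List.toFinset_card_of_nodup hc.edges_nodup]
        simp
      rw [← h1, ← Set.ncard_coe_finset, ← Set.ncard_coe_finset (edgesIn H _), coe_edgesIn_univ,
        coe_edgesIn_univ, SimpleGraph.edgeSet_deleteEdges]
      exact Set.ncard_sdiff_add_ncard_of_subset hsub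
    have hle : H.deleteEdges c.edgeSet ≤ G := (SimpleGraph.deleteEdges_le _).trans hH
    rw [hE, show j + 1 + 176 * Fintype.card V = (j + 176 * Fintype.card V) + 1 by ring]
    refine (ih _ hle ?_).union (.of_isCycle_of_le hH hc) ?_
    · refine le_trans ?_ h
      rw [pow_succ', ← mul_assoc]
      have hr : (0 : ℝ) ≤ 1 - a / (32 * Fintype.card V) := by
        rw [sub_nonneg, div_le_one (by positivity)]
        exact_mod_cast han
      gcongr
      have h1 : ((edgesIn (H.deleteEdges c.edgeSet) Finset.univ).card : ℝ) + c.length =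
        (edgesIn H Finset.univ).card := by exact_mod_cast hcard
      have h2 : (a : ℝ) * (edgesIn H Finset.univ).card ≤ 32 * Fintype.card V * c.length := by
        exact_mod_cast hlen
      -- The cycle carries at least the fraction `a / (32 n)` of the edges, which is the factor
      -- gained in each round.
      have h3 : (edgesIn H Finset.univ).card * ((a : ℝ) / (32 * Fintype.card V)) ≤ c.length := by
        rw [mul_div_assoc', div_le_iff₀ (by positivity)]
        linarith
      linarith
    · rw [SimpleGraph.edgeSet_deleteEdges]
      exact Set.disjoint_sdiff_left

end LocallySparse

/-! ### Path families in which every vertex is an end of exactly two paths. -/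

section PathFamily

variable {V : Type*}

/-- The set of edges between consecutive entries of a list. -/
def pathEdges : List V → Set (Sym2 V)
  | [] => ∅
  | [_] => ∅
  | x :: y :: l => insert s(x, y) (pathEdges (y :: l))

theorem mem_of_mem_pathEdges {u v : V} : ∀ {l : List V}, s(u, v) ∈ pathEdges l → u ∈ l ∧ v ∈ l
  | [], h => h.elim
  | [_], h => h.elim
  | x :: y :: l, h => by
    rcases h with h | h
    · rcases Sym2.eq_iff.1 h with ⟨rfl, rfl⟩ | ⟨rfl, rfl⟩ <;> simp
    · have := mem_of_mem_pathEdges h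
      exact ⟨List.mem_cons_of_mem _ this.1, List.mem_cons_of_mem _ this.2⟩

theorem pathEdges_append_cons {z : V} (x : V) (r : List V) :
    ∀ {l : List V}, l.getLast? = some z →
      pathEdges (l ++ x :: r) = insert s(z, x) (pathEdges l ∪ pathEdges (x :: r))
  | [], h => by simp at h
  | [w], h => by
    obtain rfl : w = z := by simpa using h
    simp [pathEdges]
  | w :: w' :: l, h => by
    have h' : (w' :: l).getLast? = some z := by simpa using h
    have := pathEdges_append_cons x r h'
    simp only [List.cons_append, pathEdges] at this ⊢
    rw [this, Set.insert_comm, Set.insert_union]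

theorem pathEdges_reverse : ∀ l : List V, pathEdges l.reverse = pathEdges l
  | [] => rfl
  | [_] => rfl
  | x :: y :: l => by
    have h : (y :: l).reverse.getLast? = some y := by simp
    rw [List.reverse_cons, pathEdges_append_cons x [] h, pathEdges_reverse (y :: l), Sym2.eq_swap]
    simp [pathEdges]

theorem exists_isPath_of_list {G : SimpleGraph V} : ∀ (l : List V) (a b : V), l.Nodup →
    pathEdges l ⊆ G.edgeSet → l.head? = some a → l.getLast? = some b →
    ∃ p : G.Walk a b, p.IsPath ∧ p.edgeSet = pathEdges l ∧ p.support = l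
  | [], a, b, _, _, h, _ => by simp at h
  | [x], a, b, _, _, h, h' => by
    obtain rfl : x = a := by simpa using h
    obtain rfl : x = b := by simpa using h'
    exact ⟨.nil, .nil, by simp [pathEdges, SimpleGraph.Walk.edgeSet], rfl⟩
  | x :: y :: l, a, b, hn, hE, h, h' => by
    obtain rfl : x = a := by simpa using h
    have hxy : G.Adj x y := hE (Set.mem_insert _ _)
    obtain ⟨p, hp, hpe, hps⟩ := exists_isPath_of_list (y :: l) y b hn.of_cons
      ((Set.subset_insert _ _).trans hE) rfl (by simpa using h')
    refine ⟨.cons hxy p, hp.cons ?_, ?_, by simp [hps]⟩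
    · rw [hps]
      exact (List.nodup_cons.1 hn).1
    · rw [pathEdges, ← hpe]
      ext e
      simp [SimpleGraph.Walk.edgeSet]

theorem append_cons_inj {x : V} : ∀ {l l' r r' : List V}, x ∉ l → x ∉ l' →
    l ++ x :: r = l' ++ x :: r' → l = l'
  | [], [], _, _, _, _, _ => rfl
  | [], w :: l', _, _, _, h', h => by
    simp only [List.nil_append, List.cons_append, List.cons.injEq] at h
    simp [h.1] at h'
  | w :: l, [], _, _, h', _, h => by
    simp only [List.nil_append, List.cons_append, List.cons.injEq] at h
    simp [h.1] at h'
  | w :: l, w' :: l', _, _, h1, h2, h => by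
    simp only [List.cons_append, List.cons.injEq] at h
    rw [h.1, append_cons_inj (fun h => h1 (List.mem_cons_of_mem _ h))
      (fun h => h2 (List.mem_cons_of_mem _ h)) h.2]

variable {ι : Type*}

/-- The `i`-th list of the family, read from the front or from the back. -/
def sideView (P : ι → List V) (q : ι × Bool) : List V :=
  if q.2 then (P q.1).reverse else P q.1

theorem sideView_not (P : ι → List V) (i : ι) (b : Bool) :
    sideView P (i, !b) = (sideView P (i, b)).reverse := by
  cases b <;> simp [sideView]

theorem pathEdges_sideView (P : ι → List V) (q : ι × Bool) :
    pathEdges (sideView P q) = pathEdges (P q.1) := by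
  unfold sideView
  split <;> simp [pathEdges_reverse]

/-- A family of edge-disjoint paths with edge set `E`; the ends of the paths are given by `h`. -/
structure IsPathFamily (P : ι → List V) (h : ι × Bool → V) (E : Set (Sym2 V)) : Prop where
  nodup : ∀ i, (P i).Nodup
  head : ∀ q, (sideView P q).head? = some (h q)
  cover : ∀ e, e ∈ E ↔ ∃ i, e ∈ pathEdges (P i)
  disjoint : ∀ i j, i ≠ j → Disjoint (pathEdges (P i)) (pathEdges (P j))

variable [DecidableEq ι] {P : ι → List V} {h : ι × Bool → V} {E E' : Set (Sym2 V)}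

/-- Replace the path seen from `q` by `L`. -/
def replaceSide (P : ι → List V) (q : ι × Bool) (L : List V) : ι → List V :=
  Function.update P q.1 (if q.2 then L.reverse else L)

theorem sideView_replaceSide (q : ι × Bool) (L : List V) :
    sideView (replaceSide P q L) q = L := by
  obtain ⟨i, b⟩ := q
  cases b <;> simp [sideView, replaceSide]

theorem sideView_replaceSide_of_ne {q q' : ι × Bool} (hq : q'.1 ≠ q.1) (L : List V) :
    sideView (replaceSide P q L) q' = sideView P q' := by
  simp [sideView, replaceSide, Function.update_of_ne hq]

theorem pathEdges_replaceSide (q : ι × Bool) (L : List V) :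
    pathEdges (replaceSide P q L q.1) = pathEdges L := by
  rw [← pathEdges_sideView, sideView_replaceSide]

theorem replaceSide_of_ne {q : ι × Bool} {j : ι} (hj : j ≠ q.1) (L : List V) :
    replaceSide P q L j = P j := by
  simp [replaceSide, Function.update_of_ne hj]

theorem eq_or_eq_not_or_ne (q q' : ι × Bool) : q' = q ∨ q' = (q.1, !q.2) ∨ q'.1 ≠ q.1 := by
  obtain ⟨i, b⟩ := q
  obtain ⟨i', b'⟩ := q'
  by_cases hi : i' = i
  · subst hi
    cases b <;> cases b' <;> simp
  · exact .inr (.inr hi)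

/-- The single surgery used below: one path is rebuilt with its far end kept, so only the end `q`
moves. -/
theorem IsPathFamily.replace (hP : IsPathFamily P h E) (q : ι × Bool) (L : List V) (y : V)
    (hn : L.Nodup) (hy : L.head? = some y) (hl : L.getLast? = (sideView P q).getLast?)
    (hE : ∀ e, e ∈ E' ↔ (e ∈ E ∧ e ∉ pathEdges (sideView P q)) ∨ e ∈ pathEdges L)
    (hd : ∀ e ∈ pathEdges L, e ∈ E → e ∈ pathEdges (sideView P q)) :
    IsPathFamily (replaceSide P q L) (Function.update h q y) E' := by
  rw [pathEdges_sideView] at hE hd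
  have hdis : ∀ j, j ≠ q.1 → Disjoint (pathEdges L) (pathEdges (P j)) := by
    intro j hj
    rw [Set.disjoint_left]
    intro e he hej
    exact Set.disjoint_left.1 (hP.disjoint j q.1 hj) hej
      (hd e he ((hP.cover e).2 ⟨j, hej⟩))
  refine ⟨fun i => ?_, fun q' => ?_, fun e => ?_, fun i j hij => ?_⟩
  · by_cases hi : i = q.1
    · subst hi
      simp only [replaceSide, Function.update_self]
      split <;> simp [hn]
    · rw [replaceSide_of_ne hi]
      exact hP.nodup i
  · rcases eq_or_eq_not_or_ne q q' with rfl | rfl | hne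
    · rw [sideView_replaceSide, Function.update_self, hy]
    · have h1 := hP.head (q.1, !q.2)
      rw [sideView_not, List.head?_reverse] at h1
      rw [sideView_not, List.head?_reverse, sideView_replaceSide, hl,
        Function.update_of_ne (by simp [Prod.ext_iff]), ← h1]
    · rw [sideView_replaceSide_of_ne hne, Function.update_of_ne (by rintro rfl; exact hne rfl)]
      exact hP.head q'
  · rw [hE, hP.cover]
    constructor
    · rintro (⟨⟨j, hj⟩, h2⟩ | h2)
      · have hjq : j ≠ q.1 := by rintro rfl; exact h2 hj
        exact ⟨j, by rwa [replaceSide_of_ne hjq]⟩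
      · exact ⟨q.1, by rwa [pathEdges_replaceSide]⟩
    · rintro ⟨j, hj⟩
      by_cases hjq : j = q.1
      · subst hjq
        rw [pathEdges_replaceSide] at hj
        exact .inr hj
      · rw [replaceSide_of_ne hjq] at hj
        exact .inl ⟨⟨j, hj⟩, fun h2 => Set.disjoint_left.1 (hP.disjoint j q.1 hjq) hj h2⟩
  · by_cases hi : i = q.1
    · subst hi
      rw [pathEdges_replaceSide, replaceSide_of_ne hij.symm]
      exact hdis j hij.symm
    · rw [replaceSide_of_ne hi]
      by_cases hj : j = q.1
      · subst hj
        rw [pathEdges_replaceSide]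
        exact (hdis i hi).symm
      · rw [replaceSide_of_ne hj]
        exact hP.disjoint i j hij

variable [DecidableEq V] [Fintype ι]

/-- The number of path ends at `v`. -/
def endCount (h : ι × Bool → V) (v : V) : ℕ := (Finset.univ.filter fun q => h q = v).card

theorem endCount_update (h : ι × Bool → V) (q : ι × Bool) (y v : V) :
    endCount (Function.update h q y) v + (if v = h q then 1 else 0) =
      endCount h v + (if v = y then 1 else 0) := by
  simp only [endCount, Finset.card_filter]
  rw [← Finset.add_sum_erase _ _ (Finset.mem_univ q),
    ← Finset.add_sum_erase (a := q) (f := fun q => if h q = v then 1 else 0) _ (Finset.mem_univ q)]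
  have : ∑ q' ∈ Finset.univ.erase q, (if Function.update h q y q' = v then 1 else 0) =
      ∑ q' ∈ Finset.univ.erase q, (if h q' = v then 1 else 0) := by
    refine Finset.sum_congr rfl fun q' hq' => ?_
    rw [Function.update_of_ne (Finset.ne_of_mem_erase hq')]
  rw [this, Function.update_self]
  simp only [eq_comm (a := v)]
  omega

/-- The edge `xy` is the only one of `E` not yet covered. Take a path starting at `y`. If it avoids
`x`, prepend `x`. If it reads `y … z x …`, rotate it to `z … y x …`: now `xz` is uncovered and the
end at `y` has moved to `z`, so the argument repeats with `z`. The set `S` holds the candidates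
still available for `y` and shrinks at each rotation. The last hypothesis ensures that the next `z`
lies in `S`. -/
theorem IsPathFamily.insert_edge_aux {x : V} : ∀ (n : ℕ) (S : Finset V) (P : ι → List V)
    (h : ι × Bool → V) (y : V) (f : V → ι × Bool), S.card = n →
    IsPathFamily P h (E \ {s(x, y)}) → s(x, y) ∈ E → y ∈ S → x ∉ S → (∀ z ∈ S, h (f z) = z) →
    (∀ w ∈ S, ∀ A B z, sideView P (f w) = A ++ z :: x :: B → z ∈ S) →
    ∃ (P' : ι → List V) (h' : ι × Bool → V), IsPathFamily P' h' E ∧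
      ∀ v, endCount h' v + (if v = y then 1 else 0) = endCount h v + (if v = x then 1 else 0) := by
  intro n
  induction n with
  | zero =>
    intro S P h y f hS _ _ hy
    rw [Finset.card_eq_zero] at hS
    simp [hS] at hy
  | succ n ih =>
    intro S P h y f hS hP hxyE hyS hxS hf hpred
    set q := f y with hq
    have hhq : h q = y := hf y hyS
    have hxy : x ≠ y := by rintro rfl; exact hxS hyS
    have hhead := hP.head q
    rw [hhq] at hhead
    have hnd : (sideView P q).Nodup := by
      unfold sideView
      split <;> simp [hP.nodup]
    have hsubE : pathEdges (sideView P q) ⊆ E \ {s(x, y)} := by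
      intro e he
      rw [pathEdges_sideView] at he
      exact (hP.cover e).2 ⟨_, he⟩
    by_cases hx : x ∈ sideView P q
    · obtain ⟨T, r, hTr⟩ := List.append_of_mem hx
      have hTne : T ≠ [] := by
        rintro rfl
        rw [hTr] at hhead
        exact hxy (by simpa using hhead)
      obtain ⟨A, z, rfl⟩ : ∃ A z, T = A ++ [z] := ⟨_, _, (List.dropLast_append_getLast hTne).symm⟩
      have hlast : (A ++ [z]).getLast? = some z := by simp
      have hThead : (A ++ [z]).head? = some y := by
        rw [hTr, List.head?_append] at hhead
        cases A <;> simpa using hhead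
      rw [hTr] at hnd
      have hnd' := List.nodup_append.1 hnd
      have hxT : x ∉ A ++ [z] := fun hxT => hnd'.2.2 x hxT x (by simp) rfl
      have hzr : z ∉ x :: r := fun hz => hnd'.2.2 z (by simp) z hz rfl
      have hold : pathEdges (sideView P q) =
          insert s(z, x) (pathEdges (A ++ [z]) ∪ pathEdges (x :: r)) := by
        rw [hTr, pathEdges_append_cons x r hlast]
      have hnew : pathEdges ((A ++ [z]).reverse ++ x :: r) =
          insert s(y, x) (pathEdges (A ++ [z]) ∪ pathEdges (x :: r)) := by
        rw [pathEdges_append_cons x r (by rw [List.getLast?_reverse, hThead]), pathEdges_reverse]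
      have hzS : z ∈ S := hpred y hyS A r z (by rw [← hq, hTr]; simp)
      have hzxE : s(z, x) ∈ E \ {s(x, y)} := hsubE (by rw [hold]; simp)
      have hzy : z ≠ y := by
        rintro rfl
        exact hzxE.2 (by rw [Set.mem_singleton_iff, Sym2.eq_swap])
      have hzx1 : s(z, x) ∉ pathEdges (A ++ [z]) := fun hm => hxT (mem_of_mem_pathEdges hm).2
      have hzx2 : s(z, x) ∉ pathEdges (x :: r) := fun hm => hzr (mem_of_mem_pathEdges hm).1
      have hP1 : IsPathFamily (replaceSide P q ((A ++ [z]).reverse ++ x :: r))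
          (Function.update h q z) (E \ {s(x, z)}) := by
        refine hP.replace q _ z ?_ (by simp) ?_ ?_ ?_
        · rw [List.nodup_append, List.nodup_reverse]
          exact ⟨hnd'.1, hnd'.2.1, fun a ha b hb => hnd'.2.2 a (List.mem_reverse.1 ha) b hb⟩
        · rw [hTr, List.getLast?_append_of_ne_nil _ (List.cons_ne_nil _ _),
            List.getLast?_append_of_ne_nil _ (List.cons_ne_nil _ _)]
        · intro e
          rw [hold, hnew]
          simp only [Set.mem_sdiff, Set.mem_singleton_iff, Set.mem_insert_iff, Set.mem_union,
            not_or]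
          rw [Sym2.eq_swap (a := x) (b := z), Sym2.eq_swap (a := y) (b := x)]
          have hsub2 : ∀ e, e ∈ pathEdges (A ++ [z]) ∨ e ∈ pathEdges (x :: r) → e ∈ E := by
            intro e he
            exact (hsubE (by rw [hold]; exact .inr he)).1
          have hne : s(x, y) ≠ s(z, x) := by
            intro heq
            exact hzxE.2 heq.symm
          constructor
          · rintro ⟨h1, h2⟩
            by_cases h3 : e = s(x, y)
            · exact .inr (.inl h3)
            by_cases h4 : e ∈ pathEdges (A ++ [z]) ∨ e ∈ pathEdges (x :: r)
            · exact .inr (.inr h4)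
            · rw [not_or] at h4
              exact .inl ⟨⟨h1, h3⟩, h2, h4.1, h4.2⟩
          · rintro (⟨⟨h1, h3⟩, h2, h4⟩ | rfl | h4)
            · exact ⟨h1, h2⟩
            · exact ⟨hxyE, hne⟩
            · refine ⟨hsub2 e h4, ?_⟩
              rintro rfl
              exact h4.elim hzx1 hzx2
        · intro e he heE
          rw [hnew] at he
          rw [hold]
          rcases he with rfl | he
          · exact absurd (by rw [Set.mem_singleton_iff, Sym2.eq_swap]) heE.2
          · exact .inr he
      obtain ⟨P', h', hP', hcount⟩ := ih (S.erase y) _ _ z f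
        (by rw [Finset.card_erase_of_mem hyS]; omega) hP1
        (by rw [Sym2.eq_swap]; exact hzxE.1) (Finset.mem_erase.2 ⟨hzy, hzS⟩)
        (fun hm => hxS (Finset.mem_of_mem_erase hm))
        (by
          intro w hw
          have hwS := Finset.mem_of_mem_erase hw
          rw [Function.update_of_ne, hf w hwS]
          intro heq
          have := hf w hwS
          rw [heq, hhq] at this
          exact Finset.ne_of_mem_erase hw this.symm)
        (by
          intro w hw A' B z' hview
          have hwS := Finset.mem_of_mem_erase hw
          have hwq : f w ≠ q := by
            intro heq
            have := hf w hwS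
            rw [heq, hhq] at this
            exact Finset.ne_of_mem_erase hw this.symm
          have hz'S : z' ∈ S ∧ s(z', x) ∈ pathEdges (sideView P (f w)) := by
            -- The rotation does not change the predecessor of `x` in any view other than the one
            -- from `q`, and `f w = q` only for `w = y`. From the far side of the rotated path, the
            -- part before `x` is untouched.
            have key : ∃ B', sideView P (f w) = A' ++ z' :: x :: B' := by
              rcases eq_or_eq_not_or_ne q (f w) with h1 | h1 | h1
              · exact absurd h1 hwq
              · rw [h1, sideView_not, sideView_replaceSide] at hview
                simp only [List.reverse_append, List.reverse_cons, List.append_assoc,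
                  List.singleton_append, List.reverse_reverse] at hview
                refine ⟨(A ++ [z]).reverse, ?_⟩
                rw [h1, sideView_not, hTr]
                simp only [List.reverse_append, List.reverse_cons, List.append_assoc,
                  List.singleton_append]
                have hxr : x ∉ r.reverse := by
                  intro hm
                  exact (List.nodup_cons.1 hnd'.2.1).1 (List.mem_reverse.1 hm)
                have hnd2 : (r.reverse ++ x :: (A ++ [z])).Nodup := by
                  rw [List.nodup_append, List.nodup_reverse, List.nodup_cons]
                  refine ⟨hnd'.2.1.of_cons, ⟨hxT, hnd'.1⟩, fun a ha b hb hab => ?_⟩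
                  subst hab
                  rcases List.mem_cons.1 hb with rfl | hb
                  · exact hxr ha
                  · exact hnd'.2.2 a hb a (List.mem_cons_of_mem _ (List.mem_reverse.1 ha)) rfl
                have hview' : r.reverse ++ x :: (A ++ [z]) = (A' ++ [z']) ++ x :: B := by
                  simpa using hview
                have hxA' : x ∉ A' ++ [z'] := by
                  intro hm
                  rw [hview'] at hnd2
                  exact (List.nodup_append.1 hnd2).2.2 x hm x (by simp) rfl
                rw [append_cons_inj hxr hxA' hview']
                simp
              · rw [sideView_replaceSide_of_ne h1] at hview
                exact ⟨B, hview⟩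
            obtain ⟨B', hB'⟩ := key
            refine ⟨hpred w hwS A' B' z' hB', ?_⟩
            rw [hB', show A' ++ z' :: x :: B' = (A' ++ [z']) ++ x :: B' by simp,
              pathEdges_append_cons (z := z') x B' (by simp)]
            exact Set.mem_insert _ _
          -- The predecessor cannot be `y`, since before the rotation `xy` was covered by no path.
          refine Finset.mem_erase.2 ⟨?_, hz'S.1⟩
          rintro rfl
          have h2 := hz'S.2
          rw [pathEdges_sideView] at h2
          have h3 : s(z', x) ∈ E \ {s(x, z')} := (hP.cover _).2 ⟨_, h2⟩
          exact h3.2 (by rw [Set.mem_singleton_iff, Sym2.eq_swap]))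
      refine ⟨P', h', hP', fun v => ?_⟩
      have h1 := hcount v
      have h2 := endCount_update h q z v
      rw [hhq] at h2
      omega
    · refine ⟨_, _, hP.replace q (x :: sideView P q) x (E' := E) (List.nodup_cons.2 ⟨hx, hnd⟩) rfl
        ?_ ?_ ?_, fun v => ?_⟩
      · cases hs : sideView P q with
        | nil => simp [hs] at hhead
        | cons a l => simp
      · have : pathEdges (x :: sideView P q) = insert s(x, y) (pathEdges (sideView P q)) := by
          cases hs : sideView P q with
          | nil => simp [hs] at hhead
          | cons a l =>
            obtain rfl : a = y := by simpa [hs] using hhead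
            rfl
        intro e
        rw [this]
        constructor
        · intro he
          by_cases h1 : e = s(x, y)
          · exact .inr (.inl h1)
          · by_cases h2 : e ∈ pathEdges (sideView P q)
            · exact .inr (.inr h2)
            · exact .inl ⟨⟨he, h1⟩, h2⟩
        · rintro (h1 | rfl | h1)
          · exact h1.1.1
          · exact hxyE
          · exact (hsubE h1).1
      · have : pathEdges (x :: sideView P q) = insert s(x, y) (pathEdges (sideView P q)) := by
          cases hs : sideView P q with
          | nil => simp [hs] at hhead
          | cons a l =>
            obtain rfl : a = y := by simpa [hs] using hhead
            rfl
        intro e he heE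
        rw [this] at he
        rcases he with he | he
        · exact absurd he heE.2
        · exact he
      · have := endCount_update h q x v
        rwa [hhq] at this

/-- If every vertex is an end of some path, an edge can be added to the family,
which moves a path end along this edge. -/
theorem IsPathFamily.insert_edge [Fintype V] (hP : IsPathFamily P h E) {x y : V} (hxy : x ≠ y)
    (hE : s(x, y) ∉ E) (hc : ∀ v, 1 ≤ endCount h v) :
    ∃ (P' : ι → List V) (h' : ι × Bool → V), IsPathFamily P' h' (insert s(x, y) E) ∧
      ∀ v, endCount h' v + (if v = y then 1 else 0) = endCount h v + (if v = x then 1 else 0) := by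
  have hex : ∀ v, ∃ q, h q = v := by
    intro v
    obtain ⟨q, hq⟩ := Finset.card_pos.1 (hc v)
    exact ⟨q, (Finset.mem_filter.1 hq).2⟩
  choose f hf using hex
  refine IsPathFamily.insert_edge_aux _ (Finset.univ.erase x) P h y f rfl ?_ (Set.mem_insert _ _)
    (Finset.mem_erase.2 ⟨hxy.symm, Finset.mem_univ _⟩) (Finset.notMem_erase _ _)
    (fun z _ => hf z) ?_
  · rwa [Set.insert_sdiff_self_of_notMem hE]
  · intro w _ A B z hview
    refine Finset.mem_erase.2 ⟨?_, Finset.mem_univ _⟩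
    rintro rfl
    have hnd : (sideView P (f w)).Nodup := by
      unfold sideView
      split <;> simp [hP.nodup]
    rw [hview] at hnd
    have := (List.nodup_append.1 hnd).2.1
    simp at this

/-- Inserting the trail edge by edge carries one path end from `a` to `b`. A spare end at the
current vertex keeps every count at least one when that end leaves, and it becomes the spare end at
the next vertex. -/
theorem IsPathFamily.insert_trail [Fintype V] {G : SimpleGraph V} {a b : V} (w : G.Walk a b) :
    ∀ {P : ι → List V} {h : ι × Bool → V} {E : Set (Sym2 V)}, IsPathFamily P h E → w.IsTrail →
    Disjoint E w.edgeSet → (∀ v, 1 ≤ endCount h v) → 2 ≤ endCount h a →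
    ∃ (P' : ι → List V) (h' : ι × Bool → V), IsPathFamily P' h' (E ∪ w.edgeSet) ∧
      ∀ v, endCount h' v + (if v = a then 1 else 0) = endCount h v + (if v = b then 1 else 0) := by
  induction w with
  | nil =>
    intro P h E hP _ _ _ _
    exact ⟨P, h, by simpa [SimpleGraph.Walk.edgeSet] using hP, fun v => rfl⟩
  | @cons a c b hac w ih =>
    intro P h E hP hw hd hc ha
    have hset : (SimpleGraph.Walk.cons hac w).edgeSet = insert s(c, a) w.edgeSet := by
      ext e
      simp [SimpleGraph.Walk.edgeSet, Sym2.eq_swap (a := c)]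
    rw [hset, Set.disjoint_insert_right] at hd
    rw [SimpleGraph.Walk.isTrail_cons] at hw
    obtain ⟨P1, h1, hP1, hc1⟩ := hP.insert_edge hac.ne' hd.1 hc
    obtain ⟨P2, h2, hP2, hc2⟩ := ih hP1 hw.1 (by
      rw [Set.disjoint_insert_left]
      refine ⟨fun hm => hw.2 ?_, hd.2⟩
      rw [Sym2.eq_swap]
      exact hm) (by
      intro v
      have h3 := hc1 v
      have h4 := hc v
      by_cases hva : v = a
      · subst hva
        simp only [if_true] at h3
        omega
      · rw [if_neg hva] at h3
        omega) (by
      have h3 := hc1 c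
      have h4 := hc c
      rw [if_neg hac.ne', if_pos rfl] at h3
      omega)
    refine ⟨P2, h2, ?_, fun v => ?_⟩
    · rwa [hset, Set.union_insert, ← Set.insert_union]
    · have h3 := hc1 v
      have h4 := hc2 v
      omega

/-- The edges of every graph on `V`, apart from those of an acyclic subgraph, decompose into paths
indexed by `V` in such a way that each vertex is an end of exactly two of them. -/
theorem exists_isPathFamily [Fintype V] (G : SimpleGraph V) :
    ∃ (P : V → List V) (h : V × Bool → V) (E : Set (Sym2 V)), IsPathFamily P h E ∧
      (∀ v, endCount h v = 2) ∧ E ⊆ G.edgeSet ∧ (G.deleteEdges E).IsAcyclic := by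
  classical
  set 𝓔 : Set (Set (Sym2 V)) := {E | E ⊆ G.edgeSet ∧ ∃ (P : V → List V) (h : V × Bool → V),
    IsPathFamily P h E ∧ ∀ v, endCount h v = 2} with h𝓔
  have hne : 𝓔.Nonempty := by
    -- One-vertex paths, each contributing both of its ends to its vertex.
    refine ⟨∅, Set.empty_subset _, fun v => [v], fun q => q.1, ⟨?_, ?_, ?_, ?_⟩, ?_⟩
    · simp
    · intro q
      simp [sideView]
    · simp [pathEdges]
    · simp [pathEdges]
    · intro v
      have : (Finset.univ.filter fun q : V × Bool => q.1 = v) = {(v, false), (v, true)} := by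
        ext ⟨u, b⟩
        cases b <;> simp
      rw [endCount, this]
      simp
  obtain ⟨E, hE⟩ := (Set.toFinite 𝓔).exists_maximal hne
  obtain ⟨hEG, P, h, hP, hc⟩ := hE.prop
  refine ⟨P, h, E, hP, hc, hEG, ?_⟩
  intro v w hw
  have hwE : w.edgeSet ⊆ G.edgeSet \ E := by
    rw [← SimpleGraph.edgeSet_deleteEdges]
    exact fun e he => w.edges_subset_edgeSet he
  have hd : Disjoint E w.edgeSet := by
    rw [Set.disjoint_right]
    exact fun e he => (hwE he).2
  -- Around a cycle the moving end returns to its start, so all counts remain two and maximality of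
  -- `E` is contradicted.
  obtain ⟨P', h', hP', hc'⟩ := IsPathFamily.insert_trail w hP hw.isTrail hd
    (fun v => by rw [hc]; omega) (by rw [hc])
  have hmem : E ∪ w.edgeSet ∈ 𝓔 := by
    refine ⟨Set.union_subset hEG fun e he => (hwE he).1, P', h', hP', fun u => ?_⟩
    have := hc' u
    have := hc u
    omega
  have hle : E ∪ w.edgeSet ⊆ E := hE.le_of_ge hmem Set.subset_union_left
  have : w.edges ≠ [] := by
    intro h0
    have := hw.three_le_length
    rw [← SimpleGraph.Walk.length_edges, h0] at this
    simp at this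
  obtain ⟨e, he⟩ := List.exists_mem_of_ne_nil _ this
  exact (hwE he).2 (hle (.inr he))

end PathFamily

/-! ### Closing paths by edge-disjoint links of length two. -/

section Links

variable {V : Type*} {G : SimpleGraph V}

theorem ncard_edgeSet_le_of_isAcyclic [Fintype V] (hG : G.IsAcyclic) :
    G.edgeSet.ncard ≤ Fintype.card V := by
  classical
  rcases isEmpty_or_nonempty V with hV | hV
  · have : G.edgeSet = ∅ := by
      refine Set.eq_empty_of_forall_notMem fun e => ?_
      induction e using Sym2.ind with
      | _ x y => exact (hV.false x).elim
    simp [this]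
  obtain ⟨T, hGT, hT⟩ := SimpleGraph.exists_maximal_isAcyclic_of_le_isAcyclic le_top hG
  have hTree : T.IsTree := SimpleGraph.maximal_isAcyclic_iff_isTree.1 (by simpa using hT)
  have h1 := hTree.card_edgeFinset
  have h2 : G.edgeSet.ncard ≤ T.edgeSet.ncard :=
    Set.ncard_le_ncard (SimpleGraph.edgeSet_mono hGT) (Set.toFinite _)
  rw [← SimpleGraph.coe_edgeFinset T, Set.ncard_coe_finset] at h2
  omega

/-- A path together with an edge-disjoint path of length two with the same ends is a union of at
most two edge-disjoint cycles. -/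
theorem EdgeDecomposable.of_isPath_of_link {a b w : V} (p : G.Walk a b) (hp : p.IsPath)
    (hab : a ≠ b) (haw : G.Adj a w) (hbw : G.Adj b w) (ha : s(a, w) ∉ p.edgeSet)
    (hb : s(b, w) ∉ p.edgeSet) :
    EdgeDecomposable G (p.edgeSet ∪ {s(a, w), s(b, w)}) 2 := by
  classical
  have hne : s(a, w) ≠ s(b, w) := by
    simp [hab, haw.ne]
  rw [SimpleGraph.Walk.mem_edgeSet] at ha hb
  by_cases hw : w ∈ p.support
  · have h1 : (SimpleGraph.Walk.cons haw.symm (p.takeUntil w hw)).IsCycle := by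
      rw [SimpleGraph.Walk.cons_isCycle_iff]
      refine ⟨hp.takeUntil hw, fun h => ha ?_⟩
      rw [Sym2.eq_swap]
      exact p.edges_takeUntil_subset_edges hw h
    have h2 : (SimpleGraph.Walk.cons hbw (p.dropUntil w hw)).IsCycle := by
      rw [SimpleGraph.Walk.cons_isCycle_iff]
      exact ⟨hp.dropUntil hw, fun h => hb (p.edges_dropUntil_subset_edges hw h)⟩
    have hspec : ∀ e, e ∈ p.edges ↔ e ∈ (p.takeUntil w hw).edges ∨ e ∈ (p.dropUntil w hw).edges := by
      intro e
      conv_lhs => rw [← p.take_spec hw, SimpleGraph.Walk.edges_append, List.mem_append]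
    have h3 := (EdgeDecomposable.of_isCycle h1).union (EdgeDecomposable.of_isCycle h2) (by
      rw [Set.disjoint_left]
      intro e he he'
      simp only [SimpleGraph.Walk.mem_edgeSet, SimpleGraph.Walk.edges_cons, List.mem_cons] at he he'
      rw [Sym2.eq_swap] at he
      rcases he with rfl | he <;> rcases he' with he' | he'
      · exact hne he'
      · exact ha ((hspec _).2 (.inr he'))
      · exact hb (he' ▸ (hspec _).2 (.inl he))
      · exact hp.isTrail.disjoint_edges_takeUntil_dropUntil hw he he')
    convert h3 using 1
    ext e
    simp only [Set.mem_union, SimpleGraph.Walk.mem_edgeSet, Set.mem_insert_iff,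
      Set.mem_singleton_iff, SimpleGraph.Walk.edges_cons, List.mem_cons, hspec,
      Sym2.eq_swap (a := w) (b := a)]
    tauto
  · have h1 : (SimpleGraph.Walk.cons haw.symm (p.concat hbw)).IsCycle := by
      rw [SimpleGraph.Walk.cons_isCycle_iff]
      refine ⟨hp.concat hw hbw, ?_⟩
      rw [SimpleGraph.Walk.edges_concat, Sym2.eq_swap (a := w), List.concat_eq_append,
        List.mem_append, List.mem_singleton, not_or]
      exact ⟨ha, hne⟩
    convert (EdgeDecomposable.of_isCycle h1).mono one_le_two using 1
    ext e
    simp only [Set.mem_union, SimpleGraph.Walk.mem_edgeSet, Set.mem_insert_iff,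
      Set.mem_singleton_iff, SimpleGraph.Walk.edges_cons, List.mem_cons,
      SimpleGraph.Walk.edges_concat,
      Sym2.eq_swap (a := w) (b := a)]
    simp
    tauto

variable [Fintype V]

open scoped Classical in
/-- The common neighbours of `x` and `y`. -/
noncomputable def commonNbrs (G : SimpleGraph V) (x y : V) : Finset V :=
  Finset.univ.filter fun w => G.Adj x w ∧ G.Adj y w

theorem mem_commonNbrs {x y w : V} : w ∈ commonNbrs G x y ↔ G.Adj x w ∧ G.Adj y w := by
  simp [commonNbrs]

variable [DecidableEq V] {ι : Type*} [Fintype ι] [DecidableEq ι]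

/-- The two edges joining the ends of the `i`-th path to the vertex `w`. -/
def linkEdges (h : ι × Bool → V) (i : ι) (w : V) : Set (Sym2 V) :=
  {s(h (i, false), w), s(h (i, true), w)}

/-- If all codegrees are large, pairs of vertices covering each vertex at most twice can be joined
by edge-disjoint paths of length two. -/
theorem exists_links (L : SimpleGraph V) (h : ι × Bool → V) (K : ℕ) (hK : 0 < K)
    (hcod : ∀ x y, x ≠ y → Fintype.card ι / K + 4 * K + 4 < (commonNbrs L x y).card)
    (hends : ∀ v, endCount h v ≤ 2) (s : Finset ι) :
    (∀ i ∈ s, h (i, false) ≠ h (i, true)) →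
    ∃ w : ι → V, (∀ i ∈ s, w i ∈ commonNbrs L (h (i, false)) (h (i, true))) ∧
      (∀ i ∈ s, ∀ j ∈ s, i ≠ j → Disjoint (linkEdges h i (w i)) (linkEdges h j (w j))) ∧
      ∀ x, (s.filter fun i => w i = x).card ≤ K := by
  induction s using Finset.induction_on with
  | empty =>
    intro _
    exact ⟨fun i => h (i, false), by simp, by simp, by simp⟩
  | insert i s hi ih =>
    intro hne
    obtain ⟨w, hw1, hw2, hw3⟩ := ih fun j hj => hne j (by simp [hj])
    -- vertices used too often
    set B : Finset V := Finset.univ.filter fun x => K ≤ (s.filter fun j => w j = x).card with hB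
    have hBc : B.card ≤ Fintype.card ι / K := by
      rw [Nat.le_div_iff_mul_le hK]
      calc B.card * K = ∑ x ∈ B, K := by simp
        _ ≤ ∑ x ∈ B, (s.filter fun j => w j = x).card := by
            refine Finset.sum_le_sum fun x hx => ?_
            exact (Finset.mem_filter.1 hx).2
        _ ≤ ∑ x, (s.filter fun j => w j = x).card :=
            Finset.sum_le_sum_of_subset (Finset.subset_univ _)
        _ = s.card := (Finset.card_eq_sum_card_fiberwise (by simp)).symm
        _ ≤ Fintype.card ι := Finset.card_le_univ s
    -- vertices `x` such that the edge `ax` is used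
    let N : V → Finset V := fun a =>
      (s.filter fun j => h (j, false) = a ∨ h (j, true) = a).image w ∪
        ((s.filter fun j => w j = a).image (fun j => h (j, false)) ∪
          (s.filter fun j => w j = a).image (fun j => h (j, true)))
    have hNc : ∀ a, (N a).card ≤ 2 * K + 2 := by
      intro a
      have h1 : ((s.filter fun j => h (j, false) = a ∨ h (j, true) = a).image w).card ≤ 2 := by
        refine Finset.card_image_le.trans (le_trans ?_ (hends a))
        have : (s.filter fun j => h (j, false) = a ∨ h (j, true) = a) ⊆
            (Finset.univ.filter fun q => h q = a).image Prod.fst := by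
          intro j hj
          rcases (Finset.mem_filter.1 hj).2 with h1 | h1
          · exact Finset.mem_image.2 ⟨(j, false), by simpa using h1, rfl⟩
          · exact Finset.mem_image.2 ⟨(j, true), by simpa using h1, rfl⟩
        exact (Finset.card_le_card this).trans Finset.card_image_le
      have h2 : ((s.filter fun j => w j = a).image (fun j => h (j, false))).card ≤ K :=
        Finset.card_image_le.trans (hw3 a)
      have h3 : ((s.filter fun j => w j = a).image (fun j => h (j, true))).card ≤ K :=
        Finset.card_image_le.trans (hw3 a)
      have h4 := Finset.card_union_le
        ((s.filter fun j => h (j, false) = a ∨ h (j, true) = a).image w)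
        ((s.filter fun j => w j = a).image (fun j => h (j, false)) ∪
          (s.filter fun j => w j = a).image (fun j => h (j, true)))
      have h5 := Finset.card_union_le ((s.filter fun j => w j = a).image (fun j => h (j, false)))
          ((s.filter fun j => w j = a).image (fun j => h (j, true)))
      refine h4.trans ?_
      omega
    have hN : ∀ a x, x ∉ N a → ∀ j ∈ s, s(a, x) ∉ linkEdges h j (w j) := by
      intro a x hx j hj hmem
      simp only [N, Finset.mem_union, Finset.mem_image, Finset.mem_filter, not_or, not_exists,
        not_and, and_imp] at hx
      obtain ⟨hx1, hx2, hx3⟩ := hx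
      rcases hmem with hmem | hmem
      · rcases Sym2.eq_iff.1 hmem with ⟨h1, h2⟩ | ⟨h1, h2⟩
        · exact hx1 j hj (.inl h1.symm) h2.symm
        · exact hx2 j hj h1.symm h2.symm
      · rcases Sym2.eq_iff.1 hmem with ⟨h1, h2⟩ | ⟨h1, h2⟩
        · exact hx1 j hj (.inr h1.symm) h2.symm
        · exact hx3 j hj h1.symm h2.symm
    -- The forbidden vertices number at most |ι|/K for `B` and 2K + 2 for each of the two ends,
    -- which is the bound in `hcod`.
    obtain ⟨x, hx, hxB⟩ : ∃ x ∈ commonNbrs L (h (i, false)) (h (i, true)),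
        x ∉ B ∪ (N (h (i, false)) ∪ N (h (i, true))) := by
      refine Finset.exists_mem_notMem_of_card_lt_card
        (lt_of_le_of_lt ?_ (hcod _ _ (hne i (by simp))))
      have h1 := Finset.card_union_le B (N (h (i, false)) ∪ N (h (i, true)))
      have h2 := Finset.card_union_le (N (h (i, false))) (N (h (i, true)))
      have h3 := hNc (h (i, false))
      have h4 := hNc (h (i, true))
      omega
    simp only [Finset.mem_union, not_or] at hxB
    obtain ⟨hxB, hx1, hx2⟩ := hxB
    have hupd : ∀ j ∈ s, Function.update w i x j = w j := by
      intro j hj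
      rw [Function.update_of_ne]
      rintro rfl
      exact hi hj
    have hdis : ∀ j ∈ s, Disjoint (linkEdges h i x) (linkEdges h j (w j)) := by
      intro j hj
      rw [Set.disjoint_left]
      rintro e (rfl | rfl)
      · exact hN _ _ hx1 j hj
      · exact hN _ _ hx2 j hj
    refine ⟨Function.update w i x, ?_, ?_, ?_⟩
    · intro j hj
      rcases Finset.mem_insert.1 hj with rfl | hj
      · rwa [Function.update_self]
      · rw [hupd j hj]
        exact hw1 j hj
    · intro j hj k hk hjk
      rcases Finset.mem_insert.1 hj with hji | hjs <;>
        rcases Finset.mem_insert.1 hk with hki | hks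
      · exact absurd (hji.trans hki.symm) hjk
      · rw [hji, Function.update_self, hupd k hks]
        exact hdis k hks
      · rw [hki, Function.update_self, hupd j hjs]
        exact (hdis j hjs).symm
      · rw [hupd j hjs, hupd k hks]
        exact hw2 j hjs k hks hjk
    · intro y
      have hfs : (s.filter fun j => Function.update w i x j = y) = s.filter fun j => w j = y :=
        Finset.filter_congr fun j hj => by rw [hupd j hj]
      rw [Finset.filter_insert, Function.update_self, hfs]
      split
      · rename_i hxy
        subst hxy
        have : ¬ K ≤ (s.filter fun j => w j = x).card := fun hle => hxB (by simp [hB, hle])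
        exact (Finset.card_insert_le _ _).trans (by omega)
      · exact hw3 y

/-- The path family covers `G - L` up to a forest. Paths with their links cost 2n, the forest costs
n, and `L` without the links costs `k`; the last needs `hL` for all subgraphs, since the links
depend on `G`. -/
theorem edgeDecomposable_of_commonNbrs (L : SimpleGraph V) (hLG : L ≤ G) (K k : ℕ) (hK : 0 < K)
    (hcod : ∀ x y, x ≠ y → Fintype.card V / K + 4 * K + 4 < (commonNbrs L x y).card)
    (hL : ∀ H ≤ L, EdgeDecomposable G H.edgeSet k) :
    EdgeDecomposable G G.edgeSet (3 * Fintype.card V + k) := by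
  classical
  obtain ⟨P, h, E, hP, hc, hEG, hacyc⟩ := exists_isPathFamily (G.deleteEdges L.edgeSet)
  rw [SimpleGraph.edgeSet_deleteEdges] at hEG
  set s : Finset V := Finset.univ.filter fun i => h (i, false) ≠ h (i, true) with hs
  obtain ⟨w, hw, hwd, -⟩ := exists_links L h K hK hcod (fun v => (hc v).le) s
    (fun i hi => (Finset.mem_filter.1 hi).2)
  have hlast : ∀ i, (P i).getLast? = some (h (i, true)) := by
    intro i
    have := hP.head (i, true)
    rwa [sideView, if_pos rfl, List.head?_reverse] at this
  have hfirst : ∀ i, (P i).head? = some (h (i, false)) := fun i => hP.head (i, false)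
  have hPE : ∀ i, pathEdges (P i) ⊆ E := fun i e he => (hP.cover e).2 ⟨i, he⟩
  have hlink : ∀ i ∈ s, linkEdges h i (w i) ⊆ L.edgeSet := by
    intro i hi e he
    have h1 := mem_commonNbrs.1 (hw i hi)
    rcases he with rfl | rfl
    exacts [h1.1, h1.2]
  -- A path whose two ends coincide is a single vertex and needs no link.
  have htriv : ∀ i, i ∉ s → pathEdges (P i) = ∅ := by
    intro i hi
    have hi : h (i, false) = h (i, true) := by simpa [hs] using hi
    have h1 := hfirst i
    have h2 := hlast i
    have h3 := hP.nodup i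
    rw [hi] at h1
    cases hl : P i with
    | nil => rfl
    | cons x l =>
      rw [hl] at h1 h2 h3
      obtain rfl : x = _ := by simpa using h1
      cases l with
      | nil => rfl
      | cons y l =>
        rw [List.getLast?_cons_cons] at h2
        exact absurd (List.mem_of_getLast? h2) (List.nodup_cons.1 h3).1
  have hpart : ∀ i ∈ s, EdgeDecomposable G (pathEdges (P i) ∪ linkEdges h i (w i)) 2 := by
    intro i hi
    obtain ⟨p, hp, hpe, -⟩ := exists_isPath_of_list (G := G) (P i) _ _ (hP.nodup i)
      (fun e he => (hEG (hPE i he)).1) (hfirst i) (hlast i)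
    have h1 := mem_commonNbrs.1 (hw i hi)
    have hnot : ∀ e ∈ L.edgeSet, e ∉ p.edgeSet := by
      intro e he hm
      rw [hpe] at hm
      exact (hEG (hPE i hm)).2 he
    rw [← hpe]
    exact EdgeDecomposable.of_isPath_of_link p hp (Finset.mem_filter.1 hi).2 (hLG h1.1) (hLG h1.2)
      (hnot _ h1.1) (hnot _ h1.2)
  have h1 := EdgeDecomposable.biUnion s (fun i => pathEdges (P i) ∪ linkEdges h i (w i)) 2 hpart (by
    intro i hi j hj hij
    have key : ∀ i j, j ∈ s → Disjoint (pathEdges (P i)) (linkEdges h j (w j)) := by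
      intro i j hj
      rw [Set.disjoint_left]
      exact fun e he he' => (hEG (hPE i he)).2 (hlink j hj he')
    simp only [Set.disjoint_union_left, Set.disjoint_union_right]
    exact ⟨⟨hP.disjoint i j hij, (key j i hi).symm⟩, key i j hj, hwd i hi j hj hij⟩)
  set M : Set (Sym2 V) := ⋃ i ∈ s, linkEdges h i (w i) with hM
  have hML : M ⊆ L.edgeSet := Set.iUnion₂_subset hlink
  have hunion : (⋃ i ∈ s, (pathEdges (P i) ∪ linkEdges h i (w i))) = E ∪ M := by
    ext e
    simp only [hM, Set.mem_iUnion, Set.mem_union, exists_prop, hP.cover]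
    constructor
    · rintro ⟨i, hi, he | he⟩
      exacts [.inl ⟨i, he⟩, .inr ⟨i, hi, he⟩]
    · rintro (⟨i, he⟩ | ⟨i, hi, he⟩)
      · refine ⟨i, ?_, .inl he⟩
        by_contra hi
        simp [htriv i hi] at he
      · exact ⟨i, hi, .inr he⟩
  rw [hunion] at h1
  have hle : (G.deleteEdges L.edgeSet).deleteEdges E ≤ G :=
    (SimpleGraph.deleteEdges_le _).trans (SimpleGraph.deleteEdges_le _)
  have h2 : EdgeDecomposable G ((G.deleteEdges L.edgeSet).deleteEdges E).edgeSet
      (Fintype.card V) :=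
    (EdgeDecomposable.of_subset_edgeSet (SimpleGraph.edgeSet_mono hle) (Set.toFinite _)).mono
      (ncard_edgeSet_le_of_isAcyclic hacyc)
  have h3 := hL (L.deleteEdges M) (SimpleGraph.deleteEdges_le _)
  rw [SimpleGraph.edgeSet_deleteEdges] at h2 h3
  rw [SimpleGraph.edgeSet_deleteEdges] at h2
  have h4 := (h1.union h2 (by
    rw [Set.disjoint_left]
    rintro e (he | he) he'
    · exact he'.2 he
    · exact he'.1.2 (hML he))).union h3 (by
    rw [Set.disjoint_left]
    rintro e ((he | he) | he) he'
    · exact (hEG he).2 he'.1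
    · exact he'.2 he
    · exact he.1.2 he'.1)
  have hG : G.edgeSet = E ∪ M ∪ (G.edgeSet \ L.edgeSet) \ E ∪ L.edgeSet \ M := by
    ext e
    have hLe : e ∈ L.edgeSet → e ∈ G.edgeSet := fun h => SimpleGraph.edgeSet_mono hLG h
    have hEe : e ∈ E → e ∈ G.edgeSet \ L.edgeSet := fun h => hEG h
    have hMe : e ∈ M → e ∈ L.edgeSet := fun h => hML h
    simp only [Set.mem_union, Set.mem_sdiff] at hEe ⊢
    tauto
  rw [hG]
  refine h4.mono ?_
  have : s.card ≤ Fintype.card V := Finset.card_le_univ s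
  omega

end Links

open MeasureTheory ProbabilityTheory SimpleGraph

/-! ### Probability estimates for codegrees and local sparsity. -/

section Probability

variable {V : Type*} [Fintype V]

theorem measurableSet_simpleGraph (s : Set (SimpleGraph V)) : MeasurableSet s := by
  have : s = edgeSet ⁻¹' (edgeSet '' s) := (edgeSet_injective.preimage_image s).symm
  rw [this]
  exact measurable_edgeSet .of_discrete

theorem binomialRandom_real_subset (p : unitInterval) (F : Finset (Sym2 V))
    (hF : ∀ e ∈ F, ¬ e.IsDiag) :
    (binomialRandom V p).real {G | (F : Set (Sym2 V)) ⊆ G.edgeSet} = (p : ℝ) ^ F.card := by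
  have h1 : binomialRandom V p {G | (F : Set (Sym2 V)) ⊆ G.edgeSet} =
      setBernoulli Sym2.diagSetᶜ p {s | (F : Set (Sym2 V)) ⊆ s} := by
    rw [binomialRandom_apply', setBernoulli_apply_eq_apply_subsets _ _ {s | (F : Set (Sym2 V)) ⊆ s}]
    congr 1
    ext s
    simp only [Set.mem_image, Set.mem_ofPred_eq]
    constructor
    · rintro ⟨G, hG, rfl⟩
      exact ⟨hG, edgeSet_subset_compl_diagSet G⟩
    · rintro ⟨h, hs⟩
      have : (fromEdgeSet s).edgeSet = s := by
        rw [edgeSet_fromEdgeSet]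
        exact sdiff_eq_left.2 (Set.subset_compl_iff_disjoint_right.1 hs)
      exact ⟨fromEdgeSet s, by rwa [this], this⟩
  have h2 : (fun f : Sym2 V → Prop => {e | f e}) ⁻¹' {s | (F : Set (Sym2 V)) ⊆ s} =
      (F : Set (Sym2 V)).pi fun _ => {True} := by
    ext f
    simp [Set.subset_def, Set.mem_pi]
  rw [measureReal_def, h1, setBernoulli_apply', h2,
    Measure.infinitePi_pi _ (fun _ _ => .of_discrete)]
  have h3 : ∀ e ∈ F, (unitInterval.toNNReal p • Measure.dirac (e ∈ (Sym2.diagSet : Set (Sym2 V))ᶜ) +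
      unitInterval.toNNReal (unitInterval.symm p) • Measure.dirac False) ({True} : Set Prop) =
      unitInterval.toNNReal p := by
    intro e he
    have : (e ∈ (Sym2.diagSet : Set (Sym2 V))ᶜ) = True := by simpa using hF e he
    rw [this]
    simp
  rw [Finset.prod_congr rfl h3]
  simp

variable [DecidableEq V]

/-- Removing one `w` from `B` subtracts the event in which `xw` and `yw` are also prescribed edges.
Carrying a general `F` makes this a closed induction, with factor 1 - p² per vertex. -/
theorem measureReal_subset_and_forall_not_adj (p : unitInterval) {x y : V} (hxy : x ≠ y)
    (B : Finset V) : ∀ F : Finset (Sym2 V), (∀ e ∈ F, ¬ e.IsDiag) →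
      (∀ w ∈ B, w ≠ x ∧ w ≠ y ∧ s(x, w) ∉ F ∧ s(y, w) ∉ F) →
      (binomialRandom V p).real {G | (F : Set (Sym2 V)) ⊆ G.edgeSet ∧
        ∀ w ∈ B, ¬ (G.Adj x w ∧ G.Adj y w)} = (p : ℝ) ^ F.card * (1 - (p : ℝ) ^ 2) ^ B.card := by
  induction B using Finset.induction_on with
  | empty =>
    intro F hF _
    simpa using binomialRandom_real_subset p F hF
  | insert w B hw ih =>
    intro F hF hB
    obtain ⟨hwx, hwy, hwF1, hwF2⟩ := hB w (by simp)
    have hne : s(x, w) ≠ s(y, w) := by simp [hxy, hwx.symm]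
    set F' : Finset (Sym2 V) := insert s(x, w) (insert s(y, w) F) with hF'
    have hF'c : F'.card = F.card + 2 := by
      rw [hF', Finset.card_insert_of_notMem (by simp [hne, hwF1]),
        Finset.card_insert_of_notMem hwF2]
    have h1 := ih F hF fun u hu => hB u (by simp [hu])
    have h2 := ih F' (by
      intro e he
      rcases Finset.mem_insert.1 he with rfl | he
      · simpa using hwx.symm
      rcases Finset.mem_insert.1 he with rfl | he
      · simpa using hwy.symm
      · exact hF e he) (by
      intro u hu
      obtain ⟨hux, huy, h3, h4⟩ := hB u (by simp [hu])
      have huw : u ≠ w := by rintro rfl; exact hw hu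
      refine ⟨hux, huy, ?_, ?_⟩
      · simp only [hF', Finset.mem_insert, Sym2.eq_iff, not_or]
        exact ⟨⟨fun h => huw h.2, fun h => hux h.2⟩, ⟨fun h => hxy h.1, fun h => huy h.2⟩, h3⟩
      · simp only [hF', Finset.mem_insert, Sym2.eq_iff, not_or]
        exact ⟨⟨fun h => hxy h.1.symm, fun h => hux h.2⟩, ⟨fun h => huw h.2, fun h => huy h.2⟩, h4⟩)
    have h3 : {G : SimpleGraph V | (F : Set (Sym2 V)) ⊆ G.edgeSet ∧
        ∀ u ∈ insert w B, ¬ (G.Adj x u ∧ G.Adj y u)} =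
        {G | (F : Set (Sym2 V)) ⊆ G.edgeSet ∧ ∀ u ∈ B, ¬ (G.Adj x u ∧ G.Adj y u)} \
        {G | (F' : Set (Sym2 V)) ⊆ G.edgeSet ∧ ∀ u ∈ B, ¬ (G.Adj x u ∧ G.Adj y u)} := by
      ext G
      simp only [hF', Set.mem_ofPred_eq, Set.mem_sdiff, Finset.coe_insert, Set.insert_subset_iff,
        mem_edgeSet, Finset.forall_mem_insert]
      tauto
    rw [h3, measureReal_sdiff ?_ (measurableSet_simpleGraph _), h1, h2, hF'c,
      Finset.card_insert_of_notMem hw]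
    · ring
    · rintro G ⟨h4, h5⟩
      exact ⟨fun e he => h4 (by simp [hF', he]), h5⟩

theorem exists_disjoint_subsets {α : Type*} [DecidableEq α] (g : ℕ) : ∀ (j : ℕ) (C : Finset α),
    j * g ≤ C.card → ∃ B : ℕ → Finset α, (∀ i < j, B i ⊆ C ∧ (B i).card = g) ∧
      ∀ i < j, ∀ i' < j, i ≠ i' → Disjoint (B i) (B i') := by
  intro j
  induction j with
  | zero => exact fun C _ => ⟨fun _ => ∅, by simp, by simp⟩
  | succ j ih =>
    intro C hC
    obtain ⟨B0, hB0, hB0c⟩ := Finset.exists_subset_card_eq (s := C) (n := g) (by nlinarith)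
    obtain ⟨B, hB1, hB2⟩ := ih (C \ B0) (by
      rw [Finset.card_sdiff_of_subset hB0, hB0c]
      rw [add_mul] at hC
      omega)
    have hd : ∀ i < j, Disjoint (B i) B0 := fun i hi =>
      Finset.disjoint_of_subset_left (hB1 i hi).1 Finset.sdiff_disjoint
    refine ⟨fun i => if i = j then B0 else B i, ?_, ?_⟩
    · intro i hi
      by_cases hij : i = j
      · simp [hij, hB0, hB0c]
      · simp only [hij, if_false]
        have := hB1 i (by omega)
        exact ⟨this.1.trans Finset.sdiff_subset, this.2⟩
    · intro i hi i' hi' hne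
      by_cases hij : i = j <;> by_cases hij' : i' = j
      · omega
      · simpa [hij, hij'] using (hd i' (by omega)).symm
      · simpa [hij, hij'] using hd i (by omega)
      · simpa [hij, hij'] using hB2 i (by omega) i' (by omega) hne

/-- With high probability, the random subgraph of a graph with large codegrees has large
codegrees. -/
theorem measureReal_exists_commonNbrs_lt (p : unitInterval) (S : SimpleGraph V) (j g : ℕ)
    (hS : ∀ x y, x ≠ y → j * g ≤ (commonNbrs S x y).card) :
    (binomialRandom V p).real {G | ∃ x y, x ≠ y ∧ (commonNbrs (G ⊓ S) x y).card < j} ≤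
      (Fintype.card V : ℝ) ^ 2 * (j * (1 - (p : ℝ) ^ 2) ^ g) := by
  classical
  set μ := binomialRandom V p with hμ
  have : IsProbabilityMeasure μ := by rw [hμ]; infer_instance
  have hpair : ∀ x y : V, x ≠ y → μ.real {G | (commonNbrs (G ⊓ S) x y).card < j} ≤
      j * (1 - (p : ℝ) ^ 2) ^ g := by
    intro x y hxy
    -- Cut the common neighbourhood in `S` into `j` disjoint blocks of size `g`. A codegree below
    -- `j` leaves some block without a common neighbour in `G`.
    obtain ⟨B, hB1, hB2⟩ := exists_disjoint_subsets g j _ (hS x y hxy)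
    have hsub : {G : SimpleGraph V | (commonNbrs (G ⊓ S) x y).card < j} ⊆
        ⋃ i ∈ Finset.range j, {G | ∀ w ∈ B i, ¬ (G.Adj x w ∧ G.Adj y w)} := by
      intro G hG
      by_contra hcon
      simp only [Set.mem_iUnion, Finset.mem_range, Set.mem_ofPred_eq, not_exists, not_forall,
        not_not] at hcon hG
      have hcon' : ∀ i, i < j → ∃ w ∈ B i, G.Adj x w ∧ G.Adj y w := by
        intro i hi
        obtain ⟨w, hw, h⟩ := hcon i hi
        exact ⟨w, hw, h⟩
      have : Nonempty V := ⟨x⟩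
      choose! w hw hadj using hcon'
      have : (Finset.range j).card ≤ (commonNbrs (G ⊓ S) x y).card := by
        refine Finset.card_le_card_of_injOn w ?_ ?_
        · intro i hi
          have hi' : i < j := by simpa using hi
          have h1 := mem_commonNbrs.1 ((hB1 i hi').1 (hw i hi'))
          exact mem_commonNbrs.2 ⟨⟨(hadj i hi').1, h1.1⟩, ⟨(hadj i hi').2, h1.2⟩⟩
        · intro i hi i' hi' heq
          have h1 : i < j := by simpa using hi
          have h2 : i' < j := by simpa using hi'
          by_contra hne
          exact Finset.disjoint_left.1 (hB2 i h1 i' h2 hne) (hw i h1) (heq ▸ hw i' h2)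
      rw [Finset.card_range] at this
      omega
    calc μ.real {G | (commonNbrs (G ⊓ S) x y).card < j}
        ≤ μ.real (⋃ i ∈ Finset.range j, {G | ∀ w ∈ B i, ¬ (G.Adj x w ∧ G.Adj y w)}) :=
          measureReal_mono hsub (measure_ne_top _ _)
      _ ≤ ∑ i ∈ Finset.range j, μ.real {G | ∀ w ∈ B i, ¬ (G.Adj x w ∧ G.Adj y w)} :=
          measureReal_biUnion_finset_le _ _
      _ = ∑ i ∈ Finset.range j, (1 - (p : ℝ) ^ 2) ^ g := by
          refine Finset.sum_congr rfl fun i hi => ?_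
          have hi' : i < j := by simpa using hi
          have := measureReal_subset_and_forall_not_adj p hxy (B i) ∅ (by simp) (by
            intro w hw
            have h1 := mem_commonNbrs.1 ((hB1 i hi').1 hw)
            exact ⟨h1.1.ne', h1.2.ne', by simp, by simp⟩)
          simpa [(hB1 i hi').2] using this
      _ = j * (1 - (p : ℝ) ^ 2) ^ g := by simp
  have hp : (0 : ℝ) ≤ 1 - (p : ℝ) ^ 2 := by
    have := p.2.1
    have := p.2.2
    nlinarith
  have hsub : {G : SimpleGraph V | ∃ x y, x ≠ y ∧ (commonNbrs (G ⊓ S) x y).card < j} ⊆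
      ⋃ q ∈ (Finset.univ.filter fun q : V × V => q.1 ≠ q.2),
        {G | (commonNbrs (G ⊓ S) q.1 q.2).card < j} := by
    rintro G ⟨x, y, hxy, hG⟩
    simp only [Set.mem_iUnion]
    exact ⟨(x, y), by simpa using hxy, hG⟩
  calc μ.real {G | ∃ x y, x ≠ y ∧ (commonNbrs (G ⊓ S) x y).card < j}
      ≤ ∑ q ∈ (Finset.univ.filter fun q : V × V => q.1 ≠ q.2),
          μ.real {G | (commonNbrs (G ⊓ S) q.1 q.2).card < j} :=
        (measureReal_mono hsub (measure_ne_top _ _)).trans (measureReal_biUnion_finset_le _ _)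
    _ ≤ ∑ q ∈ (Finset.univ.filter fun q : V × V => q.1 ≠ q.2), j * (1 - (p : ℝ) ^ 2) ^ g :=
        Finset.sum_le_sum fun q hq => hpair q.1 q.2 (Finset.mem_filter.1 hq).2
    _ ≤ ∑ q : V × V, j * (1 - (p : ℝ) ^ 2) ^ g :=
        Finset.sum_le_sum_of_subset_of_nonneg (Finset.subset_univ _) fun _ _ _ => by positivity
    _ = _ := by simp [Finset.card_univ, sq]

/-- The standard bound (eNp/M)^M with Np/M ≤ 1/(2a), together with e ≤ 4. -/
theorem choose_mul_pow_le {N M a : ℕ} {p : ℝ} (hM : 0 < M) (ha : 0 < a) (hNM : 2 * N ≤ a * M)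
    (hp0 : 0 ≤ p) (hp : p ≤ 1 / (a : ℝ) ^ 2) :
    (N.choose M : ℝ) * p ^ M ≤ (2 / (a : ℝ)) ^ M := by
  have hM' : (0 : ℝ) < M := by exact_mod_cast hM
  have ha' : (0 : ℝ) < a := by exact_mod_cast ha
  have hNM' : (N : ℝ) ≤ a / 2 * M := by
    have : (2 : ℝ) * N ≤ a * M := by exact_mod_cast hNM
    linarith
  calc (N.choose M : ℝ) * p ^ M ≤ (N : ℝ) ^ M / M.factorial * p ^ M := by
        gcongr
        exact Nat.choose_le_pow_div M N
    _ ≤ (a / 2 * M : ℝ) ^ M / M.factorial * (1 / (a : ℝ) ^ 2) ^ M := by gcongr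
    _ = (M : ℝ) ^ M / M.factorial * (1 / (2 * a)) ^ M := by
        rw [mul_pow, mul_comm ((a / 2 : ℝ) ^ M), mul_div_right_comm, mul_assoc, ← mul_pow]
        congr 2
        field_simp
    _ ≤ Real.exp M * (1 / (2 * a)) ^ M := by
        gcongr
        exact Real.pow_div_factorial_le_exp _ (by positivity) _
    _ = (Real.exp 1 / (2 * a)) ^ M := by
        rw [← Real.exp_one_pow M, ← mul_pow]
        congr 1
        field_simp
    _ ≤ (2 / (a : ℝ)) ^ M := by
        gcongr ?_ ^ M
        rw [div_le_div_iff₀ (by positivity) (by positivity)]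
        have : Real.exp 1 ≤ 4 := by have := Real.exp_one_lt_d9; linarith
        nlinarith

/-- A union bound over X and over sets of M(X) edges inside X. Each X contributes at most y^|X| with
y = (2/a)⁴³, so the sum is at most (1 + y)ⁿ - 1 ≤ 2ny. The exponent 43 beats n ≤ a⁴¹, and one factor
a absorbs 2⁴³. -/
theorem measureReal_not_locallySparse_le (p : unitInterval) {a : ℕ} (ha : 2 ^ 43 ≤ a)
    (hn : Fintype.card V ≤ a ^ 41) (hp : (p : ℝ) ≤ 1 / (a : ℝ) ^ 2) :
    (binomialRandom V p).real {G | ¬ LocallySparse G a} ≤ 2 / a := by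
  classical
  set μ := binomialRandom V p with hμ
  have : IsProbabilityMeasure μ := by rw [hμ]; infer_instance
  have ha0 : 0 < a := by omega
  have ha' : (0 : ℝ) < a := by exact_mod_cast ha0
  have ha43 : (2 : ℝ) ^ 43 ≤ a := by exact_mod_cast ha
  -- The final 1 compensates the rounded quotient and is paid for by raising 43 to the 44 of
  -- `LocallySparse`, as X is nonempty.
  let M : Finset V → ℕ := fun X => 43 * X.card + 2 * X.card ^ 2 / a + 1
  let Q : Finset V → Finset (Sym2 V) := fun X => X.sym2.filter fun e => ¬ e.IsDiag
  set y : ℝ := (2 / (a : ℝ)) ^ 43 with hy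
  have hQ : ∀ X : Finset V, (Q X).card ≤ X.card ^ 2 := by
    intro X
    refine (Finset.card_filter_le _ _).trans ?_
    rw [Finset.card_sym2, Nat.choose_two_right]
    rcases Nat.eq_zero_or_pos X.card with h | h
    · simp [h]
    · apply Nat.div_le_of_le_mul
      simp only [Nat.add_sub_cancel]
      nlinarith
  have hsub : {G : SimpleGraph V | ¬ LocallySparse G a} ⊆
      ⋃ X ∈ (Finset.univ.erase ∅ : Finset (Finset V)), ⋃ F ∈ (Q X).powersetCard (M X),
        {G | (F : Set (Sym2 V)) ⊆ G.edgeSet} := by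
    intro G hG
    simp only [LocallySparse, Set.mem_ofPred_eq, not_forall, not_le] at hG
    obtain ⟨X, hX, hlt⟩ := hG
    have hc : 1 ≤ X.card := hX.card_pos
    have hM : M X ≤ (edgesIn G X).card := by
      have h1 : a * (2 * X.card ^ 2 / a) ≤ 2 * X.card ^ 2 := Nat.mul_div_le _ _
      have h2 : a * (43 * X.card + 2 * X.card ^ 2 / a + 1) ≤ 44 * a * X.card + 2 * X.card ^ 2 := by
        nlinarith
      exact (Nat.lt_of_mul_lt_mul_left (lt_of_le_of_lt h2 hlt)).le
    obtain ⟨F, hF, hFc⟩ := Finset.exists_subset_card_eq hM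
    simp only [Set.mem_iUnion]
    refine ⟨X, by simpa using hX.ne_empty, F, Finset.mem_powersetCard.2 ⟨fun e he => ?_, hFc⟩,
      fun e he => (mem_edgesIn.1 (hF he)).2⟩
    have h1 := mem_edgesIn.1 (hF he)
    exact Finset.mem_filter.2 ⟨Finset.mem_sym2_iff.2 h1.1, G.not_isDiag_of_mem_edgeSet h1.2⟩
  have hX : ∀ X ∈ (Finset.univ.erase ∅ : Finset (Finset V)),
      μ.real (⋃ F ∈ (Q X).powersetCard (M X), {G | (F : Set (Sym2 V)) ⊆ G.edgeSet}) ≤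
        y ^ X.card := by
    intro X hX
    calc μ.real (⋃ F ∈ (Q X).powersetCard (M X), {G | (F : Set (Sym2 V)) ⊆ G.edgeSet})
        ≤ ∑ F ∈ (Q X).powersetCard (M X), μ.real {G | (F : Set (Sym2 V)) ⊆ G.edgeSet} :=
          measureReal_biUnion_finset_le _ _
      _ = ∑ F ∈ (Q X).powersetCard (M X), (p : ℝ) ^ M X := by
          refine Finset.sum_congr rfl fun F hF => ?_
          rw [Finset.mem_powersetCard] at hF
          rw [binomialRandom_real_subset p F fun e he => (Finset.mem_filter.1 (hF.1 he)).2, hF.2]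
      _ = ((Q X).card.choose (M X) : ℝ) * (p : ℝ) ^ M X := by simp
      _ ≤ (2 / (a : ℝ)) ^ M X := by
          refine choose_mul_pow_le (by simp [M]) ha0 ?_ p.2.1 hp
          have h1 := hQ X
          have h2 : 2 * X.card ^ 2 < a * (2 * X.card ^ 2 / a + 1) := by
            have := Nat.div_add_mod (2 * X.card ^ 2) a
            have := Nat.mod_lt (2 * X.card ^ 2) ha0
            nlinarith
          have h3 : a * (2 * X.card ^ 2 / a + 1) ≤ a * M X := by
            refine Nat.mul_le_mul_left _ ?_
            simp only [M]
            omega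
          omega
      _ ≤ (2 / (a : ℝ)) ^ (43 * X.card) := by
          refine pow_le_pow_of_le_one (by positivity) ?_
            (Nat.le_succ_of_le (Nat.le_add_right _ _))
          rw [div_le_one ha']
          linarith
      _ = y ^ X.card := by rw [hy, ← pow_mul]
  have hy0 : 0 ≤ y := by positivity
  have hny : (Fintype.card V : ℝ) * y ≤ 1 / a := by
    have h1 : (Fintype.card V : ℝ) ≤ (a : ℝ) ^ 41 := by exact_mod_cast hn
    calc (Fintype.card V : ℝ) * y ≤ (a : ℝ) ^ 41 * y := by gcongr
      _ = 2 ^ 43 / a / a := by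
          rw [hy]
          field_simp
      _ ≤ 1 / a := by
          gcongr
          rw [div_le_one ha']
          exact ha43
  have ha1 : 1 / (a : ℝ) ≤ 1 := by
    rw [div_le_one ha']
    linarith
  calc μ.real {G | ¬ LocallySparse G a}
      ≤ ∑ X ∈ (Finset.univ.erase ∅ : Finset (Finset V)), y ^ X.card :=
        ((measureReal_mono hsub (measure_ne_top _ _)).trans (measureReal_biUnion_finset_le _ _)).trans
          (Finset.sum_le_sum hX)
    _ = (y + 1) ^ Fintype.card V - 1 := by
        have h1 := Finset.sum_pow_mul_eq_add_pow y 1 (Finset.univ : Finset V)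
        simp only [one_pow, mul_one, Finset.powerset_univ, Finset.card_univ] at h1
        rw [← h1, ← Finset.add_sum_erase _ _ (Finset.mem_univ (∅ : Finset V))]
        simp
    _ ≤ Real.exp (Fintype.card V * y) - 1 := by
        rw [Real.exp_nat_mul]
        gcongr
        exact Real.add_one_le_exp y
    _ ≤ 2 * (Fintype.card V * y) := by
        have h0 : 0 ≤ Fintype.card V * y := by positivity
        have := Real.abs_exp_sub_one_le (x := Fintype.card V * y) (by
          rw [abs_of_nonneg h0]; linarith)
        rw [abs_of_nonneg h0] at this
        exact (le_abs_self _).trans this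
    _ ≤ 2 / a := by
        rw [show (2 : ℝ) / a = 2 * (1 / a) by ring]
        gcongr

end Probability

/-! ### Decompositions obtained from sparsity and large codegrees. -/

open MeasureTheory ProbabilityTheory SimpleGraph Filter

theorem EdgeDecomposable.of_le {V : Type*} {G H : SimpleGraph V} {E : Set (Sym2 V)} {k : ℕ}
    (h : EdgeDecomposable H E k) (hHG : H ≤ G) : EdgeDecomposable G E k := by
  obtain ⟨D, h1, h2, h3, h4⟩ := h
  refine ⟨D, fun S hS => ?_, h2, h3, h4⟩
  rcases h1 S hS with ⟨v, w, hw, rfl⟩ | ⟨e, he, rfl⟩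
  · refine .inl ⟨v, w.mapLe hHG, (Walk.isCycle_mapLe hHG).2 hw, ?_⟩
    ext e
    simp [Walk.edgeSet]
  · exact .inr ⟨e, edgeSet_mono hHG he, rfl⟩

theorem one_sub_pow_le_exp {x y : ℝ} {m : ℕ} (hx : x ≤ 1) (hy : y ≤ x * m) :
    (1 - x) ^ m ≤ Real.exp (-y) := by
  calc (1 - x) ^ m ≤ Real.exp (-x) ^ m :=
        pow_le_pow_left₀ (sub_nonneg.2 hx) (Real.one_sub_le_exp_neg x) m
    _ = Real.exp (-(x * m)) := by
        rw [← Real.exp_nat_mul]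
        congr 1
        ring
    _ ≤ Real.exp (-y) := by gcongr

section Deterministic

variable {V : Type*} [Fintype V] {G : SimpleGraph V} {a : ℕ}

theorem card_edgesIn_univ_le (G : SimpleGraph V) :
    (edgesIn G Finset.univ).card ≤ Fintype.card V ^ 2 := by
  classical
  refine (Finset.card_filter_le _ _).trans ?_
  rw [Finset.card_sym2, Finset.card_univ, Nat.choose_two_right]
  rcases Nat.eq_zero_or_pos (Fintype.card V) with h | h
  · simp [h]
  · apply Nat.div_le_of_le_mul
    simp only [Nat.add_sub_cancel]
    nlinarith

variable [DecidableEq V]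

/-- After n rounds at most n² exp(-a/32) ≤ n edges would remain, because n ≤ a⁴¹; hence n cycles and
176n edges suffice. -/
theorem LocallySparse.edgeDecomposable (hG : LocallySparse G a) (ha : 0 < a)
    (han : a ≤ Fintype.card V) (hna : Fintype.card V ≤ a ^ 41)
    (hexp : (a : ℝ) ^ 41 * Real.exp (-(a / 32)) ≤ 1) {H : SimpleGraph V} (hH : H ≤ G) :
    EdgeDecomposable G H.edgeSet (177 * Fintype.card V) := by
  refine (hG.edgeDecomposable_of_le ha (by omega) (Fintype.card V) H hH ?_).mono (by omega)
  have h0 : 0 < Fintype.card V := by omega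
  have hn0 : (0 : ℝ) < Fintype.card V := by exact_mod_cast h0
  have han' : (a : ℝ) ≤ Fintype.card V := by exact_mod_cast han
  have hna' : (Fintype.card V : ℝ) ≤ (a : ℝ) ^ 41 := by exact_mod_cast hna
  have h1 : (1 - (a : ℝ) / (32 * Fintype.card V)) ^ Fintype.card V ≤ Real.exp (-(a / 32)) := by
    apply one_sub_pow_le_exp
    · rw [div_le_one (by positivity)]
      linarith
    · rw [div_mul_eq_mul_div, mul_div_mul_right _ _ hn0.ne']
  have h2 : ((edgesIn H Finset.univ).card : ℝ) ≤ (Fintype.card V : ℝ) ^ 2 := by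
    exact_mod_cast card_edgesIn_univ_le H
  calc ((edgesIn H Finset.univ).card : ℝ) * (1 - (a : ℝ) / (32 * Fintype.card V)) ^ Fintype.card V
      ≤ (Fintype.card V : ℝ) ^ 2 * Real.exp (-(a / 32)) := by
        have h3 : (0 : ℝ) ≤ 1 - (a : ℝ) / (32 * Fintype.card V) := by
          rw [sub_nonneg, div_le_one (by positivity)]
          linarith
        gcongr
    _ = Fintype.card V * (Fintype.card V * Real.exp (-(a / 32))) := by ring
    _ ≤ Fintype.card V * ((a : ℝ) ^ 41 * Real.exp (-(a / 32))) := by gcongr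
    _ ≤ Fintype.card V * 1 := by gcongr
    _ ≤ 176 * Fintype.card V := by linarith

theorem edgeDecomposable_of_locallySparse_of_commonNbrs {T : SimpleGraph V}
    (hT : LocallySparse T a) (ha : 0 < a)
    (han : a ≤ Fintype.card V) (hna : Fintype.card V ≤ a ^ 41)
    (hexp : (a : ℝ) ^ 41 * Real.exp (-(a / 32)) ≤ 1)
    (hcod : ∀ x y, x ≠ y →
      Fintype.card V / a ^ 11 + 4 * a ^ 11 + 4 < (commonNbrs (G ⊓ T) x y).card) :
    EdgeDecomposable G G.edgeSet (180 * Fintype.card V) := by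
  refine (edgeDecomposable_of_commonNbrs (G ⊓ T) inf_le_left (a ^ 11) (177 * Fintype.card V)
    (by positivity) hcod fun H hH => ?_).mono (by omega)
  exact ((hT.anti inf_le_right).edgeDecomposable ha han hna hexp hH).of_le inf_le_left

theorem card_commonNbrs_top {x y : V} (hxy : x ≠ y) :
    (commonNbrs (⊤ : SimpleGraph V) x y).card = Fintype.card V - 2 := by
  have : commonNbrs (⊤ : SimpleGraph V) x y = (Finset.univ.erase x).erase y := by
    ext w
    simp only [mem_commonNbrs, top_adj, Finset.mem_erase, Finset.mem_univ, and_true]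
    tauto
  rw [this, Finset.card_erase_of_mem (by simp [hxy.symm]), Finset.card_erase_of_mem (by simp),
    Finset.card_univ]
  omega

end Deterministic

/-! ### The two ranges of the edge probability. -/

section Random

variable {V : Type*} [Fintype V] [DecidableEq V] {a : ℕ}

/-- Blocks of size a⁵ are missed with probability at most exp(-a), since p² ≥ a⁻⁴. The factor a¹²³
bounds n² pairs times at most n blocks. -/
theorem measureReal_exists_commonNbrs_lt_le (p : unitInterval) (ha : 0 < a)
    (hna : Fintype.card V ≤ a ^ 41) (hp : 1 / (a : ℝ) ^ 2 ≤ p) (S : SimpleGraph V) (m : ℕ)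
    (hm : m ≤ Fintype.card V) (hS : ∀ x y, x ≠ y → m ≤ (commonNbrs S x y).card) :
    (binomialRandom V p).real {G | ∃ x y, x ≠ y ∧ (commonNbrs (G ⊓ S) x y).card < m / a ^ 5} ≤
      (a : ℝ) ^ 123 * Real.exp (-a) := by
  have ha' : (0 : ℝ) < a := by exact_mod_cast ha
  have hna' : (Fintype.card V : ℝ) ≤ (a : ℝ) ^ 41 := by exact_mod_cast hna
  refine (measureReal_exists_commonNbrs_lt p S (m / a ^ 5) (a ^ 5) fun x y hxy =>
    (Nat.div_mul_le_self _ _).trans (hS x y hxy)).trans ?_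
  have h1 : ((m / a ^ 5 : ℕ) : ℝ) ≤ (a : ℝ) ^ 41 := by
    exact_mod_cast ((Nat.div_le_self _ _).trans hm).trans hna
  have hp2 : 1 / (a : ℝ) ^ 4 ≤ (p : ℝ) ^ 2 := by
    calc 1 / (a : ℝ) ^ 4 = (1 / (a : ℝ) ^ 2) ^ 2 := by field_simp
      _ ≤ (p : ℝ) ^ 2 := by gcongr
  have h2 : (1 - (p : ℝ) ^ 2) ^ (a ^ 5) ≤ Real.exp (-a) := by
    apply one_sub_pow_le_exp
    · exact pow_le_one₀ p.2.1 p.2.2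
    · calc (a : ℝ) = 1 / (a : ℝ) ^ 4 * (a ^ 5 : ℕ) := by
            push_cast
            field_simp
        _ ≤ _ := by gcongr
  have h3 : (0 : ℝ) ≤ (1 - (p : ℝ) ^ 2) ^ (a ^ 5) :=
    pow_nonneg (sub_nonneg.2 (pow_le_one₀ p.2.1 p.2.2)) _
  calc (Fintype.card V : ℝ) ^ 2 * ((m / a ^ 5 : ℕ) * (1 - (p : ℝ) ^ 2) ^ (a ^ 5))
      ≤ ((a : ℝ) ^ 41) ^ 2 * ((a : ℝ) ^ 41 * Real.exp (-a)) := by gcongr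
    _ = _ := by ring

theorem measureReal_not_edgeDecomposable_le (p : unitInterval) (ha : 2 ^ 43 ≤ a)
    (han : a ^ 40 ≤ Fintype.card V) (hna : Fintype.card V ≤ a ^ 41)
    (hexp : (a : ℝ) ^ 41 * Real.exp (-(a / 32)) ≤ 1)
    (hlt : 2 / (a : ℝ) + (a : ℝ) ^ 123 * Real.exp (-a) < 1) :
    (binomialRandom V p).real {G | ¬ EdgeDecomposable G G.edgeSet (180 * Fintype.card V)} ≤
      2 / (a : ℝ) + (a : ℝ) ^ 123 * Real.exp (-a) := by
  have ha0 : 0 < a := by omega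
  have ha' : (0 : ℝ) < a := by exact_mod_cast ha0
  have han1 : a ≤ Fintype.card V := (Nat.le_self_pow (by norm_num) a).trans han
  rcases le_total (p : ℝ) (1 / (a : ℝ) ^ 2) with hp | hp
  · refine (measureReal_mono (Set.compl_subset_compl.2 fun G hsp => ?_)
      (measure_ne_top _ _)).trans ((measureReal_not_locallySparse_le p ha hna hp).trans (le_add_of_nonneg_right (by positivity)))
    exact (LocallySparse.edgeDecomposable hsp ha0 han1 hna hexp le_rfl).mono (by omega)
  · -- a sparse graph with large codegrees
    obtain ⟨T, hTsp, hTcod⟩ : ∃ T : SimpleGraph V, LocallySparse T a ∧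
        ∀ x y, x ≠ y → (Fintype.card V - 2) / a ^ 5 ≤ (commonNbrs T x y).card := by
      by_contra! hcon
      -- At p = a⁻² both requirements on `T` hold with positive probability, because the failure
      -- probabilities sum to less than 1.
      let τ : unitInterval := ⟨1 / (a : ℝ) ^ 2, by positivity, by
        rw [div_le_one (by positivity)]
        exact one_le_pow₀ (by exact_mod_cast ha0)⟩
      have h1 := measureReal_not_locallySparse_le (V := V) τ ha hna le_rfl
      have h2 := measureReal_exists_commonNbrs_lt_le (V := V) τ ha0 hna le_rfl ⊤
        (Fintype.card V - 2) (Nat.sub_le _ _) fun x y hxy => (card_commonNbrs_top hxy).ge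
      have h3 := measureReal_union_le (μ := binomialRandom V τ)
        {G : SimpleGraph V | ¬ LocallySparse G a} {G | ∃ x y, x ≠ y ∧
          (commonNbrs (G ⊓ ⊤) x y).card < (Fintype.card V - 2) / a ^ 5}
      have h4 : {G : SimpleGraph V | ¬ LocallySparse G a} ∪ {G | ∃ x y, x ≠ y ∧
          (commonNbrs (G ⊓ ⊤) x y).card < (Fintype.card V - 2) / a ^ 5} = Set.univ := by
        refine Set.eq_univ_of_forall fun G => ?_
        by_cases hG : LocallySparse G a
        · right
          simpa using hcon G hG
        · exact .inl hG
      rw [h4, probReal_univ] at h3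
      linarith
    have hm : (Fintype.card V - 2) / a ^ 5 ≤ Fintype.card V :=
      (Nat.div_le_self _ _).trans (Nat.sub_le _ _)
    refine (measureReal_mono (fun G hG => ?_) (measure_ne_top _ _)).trans
      ((measureReal_exists_commonNbrs_lt_le p ha0 hna hp T _ hm hTcod).trans
        (le_add_of_nonneg_left (by positivity)))
    by_contra hcon
    refine hG (edgeDecomposable_of_locallySparse_of_commonNbrs hTsp ha0 han1 hna hexp ?_)
    simp only [Set.mem_ofPred_eq, not_exists, not_and, not_lt] at hcon
    intro x y hxy
    refine lt_of_lt_of_le ?_ (hcon x y hxy)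
    -- The codegrees of order n/a¹⁰ must exceed n/a¹¹ + 4a¹¹ + 4; n ≥ a⁴⁰ leaves ample room.
    rw [Nat.lt_iff_add_one_le, Nat.le_div_iff_mul_le (by positivity),
      Nat.le_div_iff_mul_le (by positivity)]
    have h1 : Fintype.card V / a ^ 11 * a ^ 11 ≤ Fintype.card V := Nat.div_mul_le_self _ _
    set c := Fintype.card V / a ^ 11
    have h2 : 2 * (c * a ^ 10) ≤ c * a ^ 11 := by
      rw [pow_succ a 10]
      nlinarith [Nat.zero_le (c * a ^ 10)]
    have h3 : 2 * (4 * a ^ 21 + 5 * a ^ 10 + 2) ≤ a ^ 40 := by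
      have h5 : a ^ 10 ≤ a ^ 21 := Nat.pow_le_pow_right ha0 (by norm_num)
      have h6 : 1 ≤ a ^ 21 := Nat.one_le_pow _ _ ha0
      have h7 : a ^ 21 * a ≤ a ^ 40 := by
        rw [← pow_succ]
        exact Nat.pow_le_pow_right ha0 (by norm_num)
      nlinarith
    have h8 : (c + 4 * a ^ 11 + 4 + 1) * a ^ 5 * a ^ 5 =
        c * a ^ 10 + 4 * a ^ 21 + 5 * a ^ 10 := by ring
    rw [h8]
    omega

end Random

/-! ### Choice of `a` and passage to the limit. -/

theorem exists_pow_le_and_lt (n : ℕ) : ∃ a, a ^ 40 ≤ n ∧ n < (a + 1) ^ 40 := by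
  have hex : ∃ b, n < b ^ 40 := ⟨n + 1, lt_of_lt_of_le (Nat.lt_succ_self n)
    (Nat.le_self_pow (by norm_num) _)⟩
  classical
  have h1 := Nat.find_spec hex
  have h2 : Nat.find hex ≠ 0 := by
    intro h
    rw [h] at h1
    simp at h1
  obtain ⟨a, ha⟩ := Nat.exists_eq_succ_of_ne_zero h2
  refine ⟨a, ?_, by rw [ha] at h1; exact h1⟩
  by_contra hlt
  exact Nat.find_min hex (m := a) (by omega) (not_le.1 hlt)

theorem tendsto_pow_mul_exp_neg_div (k : ℕ) {c : ℝ} (hc : 0 < c) :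
    Tendsto (fun a : ℕ => (a : ℝ) ^ k * Real.exp (-(a / c))) atTop (nhds 0) := by
  have h1 : Tendsto (fun a : ℕ => (a : ℝ) / c) atTop atTop :=
    tendsto_natCast_atTop_atTop.atTop_div_const hc
  have h2 := ((Real.tendsto_pow_mul_exp_neg_atTop_nhds_zero k).comp h1).const_mul (c ^ k)
  rw [mul_zero] at h2
  refine h2.congr fun a => ?_
  rw [Function.comp_apply, ← mul_assoc, ← mul_pow, mul_div_cancel₀ _ hc.ne']

theorem exists_randomGraphAAS_decomposable :
    ∃ c : ℝ, 0 < c ∧ ∀ p : ℕ → unitInterval,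
      RandomGraphAAS p
        (fun n G => DecomposableIntoAtMost G (c * (n : ℝ))) := by
  refine ⟨180, by norm_num, fun p => ?_⟩
  choose a ha using exists_pow_le_and_lt
  have hatop : Tendsto a atTop atTop := by
    refine tendsto_atTop.2 fun A => ?_
    filter_upwards [eventually_ge_atTop (A ^ 40)] with n hn
    by_contra! hlt
    have h1 := (ha n).2
    have h2 : (a n + 1) ^ 40 ≤ A ^ 40 := Nat.pow_le_pow_left hlt 40
    omega
  set δ : ℕ → ℝ := fun a => 2 / (a : ℝ) + (a : ℝ) ^ 123 * Real.exp (-a) with hδ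
  have hδ0 : Tendsto δ atTop (nhds 0) := by
    have h1 := tendsto_pow_mul_exp_neg_div 123 one_pos
    simp only [div_one] at h1
    simpa using (tendsto_const_div_atTop_nhds_zero_nat (2 : ℝ)).add h1
  have hgood : ∀ᶠ b : ℕ in atTop, 2 ^ 43 ≤ b ∧ (b : ℝ) ^ 41 * Real.exp (-(b / 32)) ≤ 1 ∧
      δ b < 1 :=
    (eventually_ge_atTop _).and
      (((tendsto_pow_mul_exp_neg_div 41 (by norm_num)).eventually_le_const one_pos).and
        (hδ0.eventually_lt_const one_pos))
  have hlow : ∀ᶠ n : ℕ in atTop, 1 - δ (a n) ≤ (binomialRandom (Fin n) (p n)).real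
      {G | DecomposableIntoAtMost G (180 * (n : ℝ))} := by
    filter_upwards [hatop.eventually hgood] with n hn
    obtain ⟨h1, h2, h3⟩ := hn
    obtain ⟨h4, h5⟩ := ha n
    -- Rounding the root costs a factor 2⁴⁰, which one more power of `a n` absorbs.
    have h6 : n ≤ a n ^ 41 := by
      refine h5.le.trans ?_
      calc (a n + 1) ^ 40 ≤ (2 * a n) ^ 40 := Nat.pow_le_pow_left (by omega) 40
        _ = 2 ^ 40 * a n ^ 40 := by rw [mul_pow]
        _ ≤ a n * a n ^ 40 := Nat.mul_le_mul_right _ (le_trans (by norm_num) h1)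
        _ = a n ^ 41 := by ring
    have h7 := measureReal_not_edgeDecomposable_le (V := Fin n) (p n) h1 (by simpa using h4)
      (by simpa using h6) h2 h3
    have h8 : (binomialRandom (Fin n) (p n)).real
        {G | DecomposableIntoAtMost G (180 * (n : ℝ))}ᶜ ≤ δ (a n) := by
      refine (measureReal_mono (Set.compl_subset_compl.2 fun G hd => ?_) (measure_ne_top _ _)).trans h7
      exact EdgeDecomposable.decomposableIntoAtMost hd (by simp)
    rw [probReal_compl_eq_one_sub (measurableSet_simpleGraph _)] at h8
    linarith
  have hreal : Tendsto (fun n => (binomialRandom (Fin n) (p n)).real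
      {G | DecomposableIntoAtMost G (180 * (n : ℝ))}) atTop (nhds 1) := by
    refine tendsto_of_tendsto_of_tendsto_of_le_of_le' ?_ tendsto_const_nhds hlow
      (Eventually.of_forall fun n => measureReal_le_one)
    simpa using (hδ0.comp hatop).const_sub 1
  have := ENNReal.tendsto_ofReal hreal
  rw [ENNReal.ofReal_one] at this
  refine this.congr fun n => ?_
  exact ofReal_measureReal (measure_ne_top _ _)

end CycleDecomp

theorem theorem3 :
    ∃ c : ℝ, 0 < c ∧ ∀ p : ℕ → unitInterval,
      CycleDecomp.RandomGraphAAS p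
        (fun n G => CycleDecomp.DecomposableIntoAtMost G (c * (n : ℝ))) := by
  exact CycleDecomp.exists_randomGraphAAS_decomposable
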